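/- Let $(X,\mathfrak B,\mu)$ be a standard Borel space with a $\sigma$-finite, non-atomic measure $\mu$ such that $\mu(X)=\infty$. Let $X^*$ be the space of counting measures on $X$ (sums of at most countably many Dirac masses) with the $\sigma$-algebra generated by the maps $\omega\mapsto\omega(A)$, $A\in\mathfrak B$, and let $\mu^*$ be the law on $X^*$ of the Poisson process of intensity $\mu$: for $A\in\mathfrak B$ with $\mu(A)<\infty$ the variable $\omega\mapsto\omega(A)$ is Poisson distributed with parameter $\mu(A)$, and the variables $\omega\mapsto\omega(A_i)$ are independent for pairwise disjoint $A_i\in\mathfrak B$ of finite measure. Let $T:X\to X$ be an invertible bimeasurable transformation that is nonsingular ($\mu\circ T^{-1}\sim\mu$), put $T'=\frac{d\mu\circ T^{-1}}{d\mu}$, and let $T_*:X^*\to X^*$, $T_*\omega=\omega\circ T^{-1}$, be its Poisson suspension. **Theorem 6.1 (Theorem E).** If $T\in\mathrm{Aut}_1(X,\mu)$, i.e. $T'-1\in L^1(X,\mu)$, and $\chi(T)=\int_X(T'-1)\,d\mu\neq0$, then $T_*$ is a nonsingular transformation of $(X^*,\mu^*)$ and it is totally dissipative: there is a measurable set $B\subset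 X^*$ such that the sets $T_*^nB$, $n\in\mathbb Z$, are pairwise disjoint and $\mu^*\bigl(X^*\setminus\bigcup_{n\in\mathbb Z}T_*^nB\bigr)=0$. -/

import Mathlib

open MeasureTheory ProbabilityTheory
open scoped ENNReal NNReal

noncomputable section

namespace PoissonSuspension

/-- The transformation `S` of `(Y, ν)` is nonsingular: `ν ∘ S⁻¹` and `ν` have the same null sets. -/
def IsNonsingular {Y : Type*} [MeasurableSpace Y] (ν : Measure Y) (S : Y ≃ᵐ Y) : Prop :=
  ν.map S ≪ ν ∧ ν ≪ ν.map S

/-- `S` is totally dissipative: there is a measurable set `B` whose translates `Sⁿ B`, `n ∈ ℤ`,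
are pairwise disjoint and cover `Y` up to a null set. -/
def IsTotallyDissipative {Y : Type*} [MeasurableSpace Y] (ν : Measure Y) (S : Y ≃ᵐ Y) : Prop :=
  ∃ B : Set Y, MeasurableSet B ∧
    Pairwise (fun m n : ℤ =>
      Disjoint (((S.toEquiv : Equiv.Perm Y) ^ m) '' B) (((S.toEquiv : Equiv.Perm Y) ^ n) '' B)) ∧
    ν (⋃ n : ℤ, ((S.toEquiv : Equiv.Perm Y) ^ n) '' B)ᶜ = 0

/-- The Radon-Nikodym derivative `T' = d(μ ∘ T⁻¹)/dμ`, as a real function. -/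
def rnDer {X : Type*} [MeasurableSpace X] (μ : Measure X) (T : X ≃ᵐ X) (x : X) : ℝ :=
  ((μ.map T).rnDeriv μ x).toReal

/-- `T ∈ Aut₁(X, μ)`: `T` is nonsingular and `T' - 1 ∈ L¹(X, μ)`. -/
def MemAut₁ {X : Type*} [MeasurableSpace X] (μ : Measure X) (T : X ≃ᵐ X) : Prop :=
  IsNonsingular μ T ∧ Integrable (fun x => rnDer μ T x - 1) μ

/-- `χ(T) = ∫ (T' - 1) dμ`. -/
def chi {X : Type*} [MeasurableSpace X] (μ : Measure X) (T : X ≃ᵐ X) : ℝ :=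
  ∫ x, (rnDer μ T x - 1) ∂μ

/-- `ω` is a counting measure: a sum of at most countably many Dirac masses. -/
def IsCounting {X : Type*} [MeasurableSpace X] (ω : Measure X) : Prop :=
  ∃ (ι : Type) (_ : Countable ι) (x : ι → X), ω = Measure.sum (fun i => Measure.dirac (x i))

/-- The configuration space `X*` of all counting measures on `X`. As a subtype of `Measure X` it
carries the smallest σ-algebra for which all the maps `ω ↦ ω A`, `A` measurable, are measurable. -/
abbrev Config (X : Type*) [MeasurableSpace X] : Type _ := {ω : Measure X // IsCounting ω}

theorem IsCounting.map {X : Type*} [MeasurableSpace X] {ω : Measure X} (h : IsCounting ω)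
    (T : X ≃ᵐ X) : IsCounting (ω.map T) := by
  obtain ⟨ι, hι, x, rfl⟩ := h
  refine ⟨ι, hι, fun i => T (x i), ?_⟩
  rw [Measure.map_sum T.measurable.aemeasurable]
  simp only [Measure.map_dirac' T.measurable]

/-- The Poisson suspension `T_* : X* → X*`, `T_* ω = ω ∘ T⁻¹`. -/
def suspension {X : Type*} [MeasurableSpace X] (T : X ≃ᵐ X) : Config X ≃ᵐ Config X where
  toFun ω := ⟨ω.1.map T, ω.2.map T⟩
  invFun ω := ⟨ω.1.map T.symm, ω.2.map T.symm⟩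
  left_inv ω := Subtype.ext (by simp)
  right_inv ω := Subtype.ext (by simp)
  measurable_toFun :=
    ((Measure.measurable_map T T.measurable).comp measurable_subtype_coe).subtype_mk
  measurable_invFun :=
    ((Measure.measurable_map T.symm T.symm.measurable).comp measurable_subtype_coe).subtype_mk

/-- The defining property of the Poisson measure: `P` is the law `μ*` on `X*` of the Poisson process of intensity `μ`: for `A` of finite measure
the count `ω ↦ ω A` has the Poisson distribution of parameter `μ A`, and the counts of pairwise
disjoint sets of finite measure are independent. (Independence of a sequence means independence of
its finite subfamilies, and a finite family can be completed by empty sets.) -/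
structure IsPoissonLaw {X : Type*} [MeasurableSpace X] (μ : Measure X) (P : Measure (Config X)) :
    Prop where
  isProbabilityMeasure : IsProbabilityMeasure P
  map_count : ∀ A : Set X, MeasurableSet A → μ A ≠ ∞ →
    P.map (fun ω => ω.1 A) =
      (poissonMeasure (μ A).toNNReal).map (fun n : ℕ => (n : ℝ≥0∞))
  indep_count : ∀ A : ℕ → Set X, (∀ n, MeasurableSet (A n)) → (∀ n, μ (A n) ≠ ∞) →
    Pairwise (fun m n => Disjoint (A m) (A n)) →
    iIndepFun (fun (n : ℕ) (ω : Config X) => ω.1 (A n)) P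

theorem isCounting_sum {X ι : Type*} [MeasurableSpace X] [Countable ι] (x : ι → X) :
    IsCounting (Measure.sum (fun i => Measure.dirac (x i))) := by
  obtain ⟨f, hf⟩ := exists_injective_nat ι
  refine ⟨Set.range f, inferInstance, fun j => x ((Equiv.ofInjective f hf).symm j), ?_⟩
  ext A hA
  rw [Measure.sum_apply _ hA, Measure.sum_apply _ hA]
  exact ((Equiv.ofInjective f hf).symm.tsum_eq
    (fun i => Measure.dirac (x i) A)).symm

theorem IsCounting.sum {X : Type*} [MeasurableSpace X] {ω : ℕ → Measure X}
    (h : ∀ n, IsCounting (ω n)) : IsCounting (Measure.sum ω) := by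
  choose ι hι x hx using h
  refine ⟨Σ n, ι n, inferInstance, fun i => x i.1 i.2, ?_⟩
  ext A hA
  rw [Measure.sum_apply _ hA, Measure.sum_apply _ hA,
    ENNReal.tsum_sigma' (fun i : (Σ n, ι n) => Measure.dirac (x i.1 i.2) A)]
  refine tsum_congr fun n => ?_
  rw [hx n, Measure.sum_apply _ hA]

/-- The counting measure of a finite sequence of points. -/
def pts {X : Type*} [MeasurableSpace X] (k : ℕ) (x : Fin k → X) : Config X :=
  ⟨Measure.sum (fun i => Measure.dirac (x i)), isCounting_sum x⟩

/-- Superposition of a sequence of configurations. -/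
def superpose {X : Type*} [MeasurableSpace X] (ω : ℕ → Config X) : Config X :=
  ⟨Measure.sum (fun n => (ω n).1), IsCounting.sum fun n => (ω n).2⟩

theorem measurable_count {X : Type*} [MeasurableSpace X] {A : Set X} (hA : MeasurableSet A) :
    Measurable (fun ω : Config X => ω.1 A) :=
  (Measure.measurable_coe hA).comp measurable_subtype_coe

theorem pts_apply {X : Type*} [MeasurableSpace X] (k : ℕ) (x : Fin k → X) {A : Set X}
    (hA : MeasurableSet A) : (pts k x).1 A = ∑ i, A.indicator 1 (x i) := by
  simp [pts, hA]

theorem measurable_pts {X : Type*} [MeasurableSpace X] (k : ℕ) :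
    Measurable (pts (X := X) k) := by
  refine Measurable.subtype_mk (Measure.measurable_of_measurable_coe _ fun A hA => ?_)
  have : (fun x : Fin k → X => (Measure.sum (fun i => Measure.dirac (x i))) A)
      = fun x => ∑ i, A.indicator 1 (x i) := by
    ext x; exact pts_apply k x hA
  rw [this]
  exact Finset.measurable_fun_sum _ fun i _ =>
    (measurable_one.indicator hA).comp (measurable_pi_apply i)

theorem measurable_superpose {X : Type*} [MeasurableSpace X] :
    Measurable (superpose (X := X)) := by
  refine Measurable.subtype_mk (Measure.measurable_of_measurable_coe _ fun A hA => ?_)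
  simp_rw [Measure.sum_apply _ hA]
  exact Measurable.tsum fun n => (measurable_count hA).comp (measurable_pi_apply n)

/-- The law of the Poisson process whose intensity is a finite measure `m`:
`∑ₖ e^{-m(X)} m^k / k!`, where `m^k` is carried by the configurations of `k` points. -/
def finitePoisson {X : Type*} [MeasurableSpace X] (m : Measure X) : Measure (Config X) :=
  Measure.sum fun k : ℕ => ENNReal.ofReal (Real.exp (-m.real Set.univ) / (k.factorial : ℝ)) •
    (Measure.pi (fun _ : Fin k => m)).map (pts k)

/-- The law of the Poisson process whose intensity is `μ`: the superposition of independent Poisson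
processes whose intensities are finite measures with sum `μ`. -/
def poissonLaw {X : Type*} [MeasurableSpace X] (μ : Measure X) [SFinite μ] : Measure (Config X) :=
  (Measure.infinitePi fun n => finitePoisson (sfiniteSeq μ n)).map superpose

theorem lintegral_finitePoisson {X : Type*} [MeasurableSpace X] (m : Measure X)
    {F : Config X → ℝ≥0∞} (hF : Measurable F) :
    ∫⁻ ω, F ω ∂(finitePoisson m) = ∑' k : ℕ,
      ENNReal.ofReal (Real.exp (-m.real Set.univ) / (k.factorial : ℝ)) *
        ∫⁻ x, F (pts k x) ∂(Measure.pi (fun _ : Fin k => m)) := by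
  rw [finitePoisson, lintegral_sum_measure]
  refine tsum_congr fun k => ?_
  rw [lintegral_smul_measure, lintegral_map hF (measurable_pts k), smul_eq_mul]

theorem tsum_weights (r : ℝ) (hr : 0 ≤ r) :
    ∑' k : ℕ, ENNReal.ofReal (Real.exp (-r) / (k.factorial : ℝ)) * ENNReal.ofReal r ^ k = 1 := by
  have h := (NormedSpace.expSeries_div_hasSum_exp r).mul_left (Real.exp (-r))
  rw [← Real.exp_eq_exp_ℝ, ← Real.exp_add, neg_add_cancel, Real.exp_zero] at h
  rw [← ENNReal.ofReal_one, ← h.tsum_eq, ENNReal.ofReal_tsum_of_nonneg (fun k => by positivity)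
    h.summable]
  refine tsum_congr fun k => ?_
  rw [← ENNReal.ofReal_pow hr, ← ENNReal.ofReal_mul (by positivity)]
  congr 1; ring

instance {X : Type*} [MeasurableSpace X] (m : Measure X) [IsFiniteMeasure m] :
    IsProbabilityMeasure (finitePoisson m) := by
  refine ⟨?_⟩
  rw [← lintegral_one, lintegral_finitePoisson m measurable_const]
  refine Eq.trans (tsum_congr fun k => ?_) (tsum_weights (m.real Set.univ) measureReal_nonneg)
  simp [Measure.pi_univ]

theorem lintegral_count {X : Type*} [MeasurableSpace X] (m : Measure X) [IsFiniteMeasure m]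
    {A : Set X} (hA : MeasurableSet A) :
    ∫⁻ ω, ω.1 A ∂(finitePoisson m) = m A := by
  have h1 : ∀ k : ℕ, ∫⁻ x, (pts k x).1 A ∂(Measure.pi (fun _ : Fin k => m))
      = k * (m Set.univ ^ (k - 1) * m A) := by
    intro k
    simp_rw [pts_apply k _ hA]
    rw [lintegral_finsetSum (f := fun (i : Fin k) (x : Fin k → X) => A.indicator 1 (x i)) _
      fun i _ => (measurable_one.indicator hA).comp (measurable_pi_apply i)]
    have h2 : ∀ i : Fin k, ∫⁻ x : Fin k → X, A.indicator 1 (x i) ∂(Measure.pi (fun _ => m))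
        = m Set.univ ^ (k - 1) * m A := by
      intro i
      have := lintegral_map (μ := Measure.pi (fun _ : Fin k => m)) (g := Function.eval i)
        (f := A.indicator (1 : X → ℝ≥0∞)) (measurable_one.indicator hA) (measurable_pi_apply i)
      rw [Measure.pi_map_eval, lintegral_smul_measure, lintegral_indicator_one hA] at this
      simpa [Finset.card_erase_of_mem] using this.symm
    simp [h2]
  rw [lintegral_finitePoisson m (measurable_count hA), tsum_eq_zero_add' ENNReal.summable]
  simp_rw [h1]
  have h3 := tsum_weights (m.real Set.univ) measureReal_nonneg
  rw [Nat.cast_zero, zero_mul, mul_zero, zero_add]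
  conv_rhs => rw [← one_mul (m A), ← h3, ← ENNReal.tsum_mul_right]
  refine tsum_congr fun k => ?_
  rw [ofReal_measureReal, Nat.add_sub_cancel, ← mul_assoc, ← mul_assoc]
  congr 2
  rw [← ENNReal.ofReal_natCast, ← ENNReal.ofReal_mul (by positivity), Nat.factorial_succ]
  congr 1
  push_cast
  field_simp

theorem integral_finitePoisson {X : Type*} [MeasurableSpace X] (m : Measure X) [IsFiniteMeasure m]
    {F : Config X → ℂ} (hF : Measurable F) (hb : ∀ ω, ‖F ω‖ ≤ 1) {f : X → ℂ}
    (hFf : ∀ k (x : Fin k → X), F (pts k x) = ∏ i, f (x i)) :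
    ∫ ω, F ω ∂(finitePoisson m) = Complex.exp (∫ x, f x ∂m - m.real Set.univ) := by
  have hint : Integrable F (finitePoisson m) :=
    Integrable.of_bound hF.aestronglyMeasurable 1 (ae_of_all _ hb)
  have h := hasSum_integral_measure hint
  have h2 := (NormedSpace.expSeries_div_hasSum_exp (∫ x, f x ∂m)).mul_left
    (Complex.exp (-(m.real Set.univ : ℂ)))
  rw [← Complex.exp_eq_exp_ℂ, ← Complex.exp_add, neg_add_eq_sub] at h2
  refine h.unique (Eq.mp (congrArg (fun u => HasSum u _) (funext fun k => ?_)) h2)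
  symm
  rw [integral_smul_measure, integral_map (measurable_pts k).aemeasurable
    hF.aestronglyMeasurable]
  simp_rw [hFf]
  rw [integral_fintype_prod_eq_pow, Fintype.card_fin, ENNReal.toReal_ofReal (by positivity),
    Complex.real_smul]
  push_cast
  ring


theorem exp_sum_indicator {X ι : Type*} [Fintype ι] {A : ι → Set X}
    (hd : Pairwise (fun i j => Disjoint (A i) (A j))) (t : ι → ℝ) (x : X) :
    Complex.exp (Complex.I * ((∑ j, t j * (A j).indicator 1 x : ℝ) : ℂ)) =
      1 + ∑ j, (A j).indicator (fun _ => Complex.exp (Complex.I * t j) - 1) x := by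
  by_cases hx : ∃ j, x ∈ A j
  · obtain ⟨j, hj⟩ := hx
    have hne : ∀ i, i ≠ j → x ∉ A i := fun i hi hxi =>
      Set.disjoint_left.1 (hd hi) hxi hj
    rw [Finset.sum_eq_single j (fun i _ hi => by simp [hne i hi]) (by simp),
      Finset.sum_eq_single j (fun i _ hi => by simp [hne i hi]) (by simp)]
    simp [hj]
  · push Not at hx
    simp [hx]

/-- The exponential `exp (i ∑ tⱼ ω(Aⱼ))`. -/
def expCount {X ι : Type*} [MeasurableSpace X] [Fintype ι] (A : ι → Set X) (t : ι → ℝ)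
    (ω : Config X) : ℂ :=
  Complex.exp (Complex.I * ((∑ j, t j * (ω.1 (A j)).toReal : ℝ) : ℂ))

theorem measurable_expCount {X ι : Type*} [MeasurableSpace X] [Fintype ι] {A : ι → Set X}
    (hA : ∀ j, MeasurableSet (A j)) (t : ι → ℝ) : Measurable (expCount A t) := by
  have h : ∀ j, Measurable fun ω : Config X => (ω.1 (A j)).toReal :=
    fun j => (measurable_count (hA j)).ennreal_toReal
  have h2 : Measurable fun ω : Config X => ∑ j, t j * (ω.1 (A j)).toReal :=
    Finset.measurable_fun_sum _ fun j _ => (h j).const_mul _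
  exact Complex.measurable_exp.comp ((Complex.measurable_ofReal.comp h2).const_mul _)

theorem norm_expCount {X ι : Type*} [MeasurableSpace X] [Fintype ι] (A : ι → Set X)
    (t : ι → ℝ) (ω : Config X) : ‖expCount A t ω‖ = 1 := by
  rw [expCount, mul_comm, Complex.norm_exp_ofReal_mul_I]

theorem integral_expCount_finite {X ι : Type*} [MeasurableSpace X] [Fintype ι] {A : ι → Set X}
    (hA : ∀ j, MeasurableSet (A j)) (hd : Pairwise (fun i j => Disjoint (A i) (A j)))
    (t : ι → ℝ) (m : Measure X) [IsFiniteMeasure m] :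
    ∫ ω, expCount A t ω ∂(finitePoisson m) =
      Complex.exp (∑ j, (Complex.exp (Complex.I * t j) - 1) * m.real (A j)) := by
  have hi : ∀ j, Integrable ((A j).indicator (fun _ : X => Complex.exp (Complex.I * t j) - 1)) m :=
    fun j => (integrable_const _).indicator (hA j)
  rw [integral_finitePoisson m (measurable_expCount hA t) (fun ω => (norm_expCount A t ω).le)
    (f := fun x => 1 + ∑ j, (A j).indicator (fun _ => Complex.exp (Complex.I * t j) - 1) x)]
  · rw [integral_add (integrable_const _) (integrable_finsetSum _ fun j _ => hi j),
      integral_finsetSum _ fun j _ => hi j]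
    simp only [integral_const, integral_indicator_const _ (hA _)]
    simp [mul_comm]
  · intro k x
    simp_rw [← exp_sum_indicator hd t]
    rw [← Complex.exp_sum, expCount]
    simp_rw [pts_apply k x (hA _)]
    congr 1
    rw [← Finset.mul_sum, ← Complex.ofReal_sum, Finset.sum_comm]
    congr 3 with j
    rw [ENNReal.toReal_sum (fun i _ => by by_cases h : x i ∈ A j <;> simp [h]), Finset.mul_sum]
    refine Finset.sum_congr rfl fun i _ => ?_
    by_cases h : x i ∈ A j <;> simp [h]

theorem integral_expCount {X ι : Type*} [MeasurableSpace X] [Fintype ι] {A : ι → Set X}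
    (hA : ∀ j, MeasurableSet (A j)) (hd : Pairwise (fun i j => Disjoint (A i) (A j)))
    (t : ι → ℝ) (μ : Measure X) [SFinite μ] (hfin : ∀ j, μ (A j) ≠ ∞) :
    ∫ ω, expCount A t ω ∂(poissonLaw μ) =
      Complex.exp (∑ j, (Complex.exp (Complex.I * t j) - 1) * μ.real (A j)) := by
  set Q := Measure.infinitePi fun n => finitePoisson (sfiniteSeq μ n) with hQ
  have hμ : ∀ j, ∑' n, sfiniteSeq μ n (A j) = μ (A j) := fun j => by
    rw [← Measure.sum_apply _ (hA j), sum_sfiniteSeq]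
  have hreal : ∀ j, HasSum (fun n => (sfiniteSeq μ n).real (A j)) (μ.real (A j)) := fun j => by
    rw [measureReal_def, ← hμ j, ENNReal.tsum_toReal_eq (fun n => measure_ne_top _ _)]
    exact (ENNReal.summable_toReal (by rw [hμ j]; exact hfin j)).hasSum
  have hae : ∀ᵐ ω ∂Q, ∀ j, ∑' n, (ω n).1 (A j) ≠ ∞ := by
    refine ae_all_iff.2 fun j => ?_
    have hm : ∀ n, Measurable fun ω : ℕ → Config X => (ω n).1 (A j) :=
      fun n => (measurable_count (hA j)).comp (measurable_pi_apply n)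
    refine (ae_lt_top (Measurable.tsum hm) ?_).mono fun _ h => h.ne
    rw [lintegral_tsum fun n => (hm n).aemeasurable]
    have : ∀ n, ∫⁻ ω, (ω n).1 (A j) ∂Q = sfiniteSeq μ n (A j) := fun n => by
      rw [← lintegral_count (sfiniteSeq μ n) (hA j),
        ← Measure.infinitePi_map_eval (fun n => finitePoisson (sfiniteSeq μ n)) n,
        lintegral_map (measurable_count (hA j)) (measurable_pi_apply n)]
    simp_rw [this, hμ j]
    exact hfin j
  have hpart : ∀ M : ℕ, ∫ ω, ∏ n ∈ Finset.range M, expCount A t (ω n) ∂Q =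
      Complex.exp (∑ n ∈ Finset.range M,
        ∑ j, (Complex.exp (Complex.I * t j) - 1) * (sfiniteSeq μ n).real (A j)) := by
    intro M
    have hind : iIndepFun (fun (n : ℕ) (ω : ℕ → Config X) => expCount A t (ω n)) Q :=
      iIndepFun_infinitePi (X := fun _ => expCount A t) fun _ => measurable_expCount hA t
    have hind' := hind.precomp (g := fun i : Fin M => (i : ℕ)) Fin.val_injective
    have := hind'.integral_fun_prod_eq_prod_integral fun i =>
      ((measurable_expCount hA t).comp (measurable_pi_apply _)).aestronglyMeasurable
    simp_rw [Finset.prod_range, Finset.sum_range]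
    rw [Complex.exp_sum]
    refine this.trans (Finset.prod_congr rfl fun i _ => ?_)
    rw [← integral_expCount_finite hA hd t,
      ← Measure.infinitePi_map_eval (fun n => finitePoisson (sfiniteSeq μ n)) (i : ℕ),
      integral_map (measurable_pi_apply _).aemeasurable
        (measurable_expCount hA t).aestronglyMeasurable]
  have hlim1 : Filter.Tendsto (fun M : ℕ => ∫ ω, ∏ n ∈ Finset.range M, expCount A t (ω n) ∂Q)
      Filter.atTop (nhds (Complex.exp
        (∑ j, (Complex.exp (Complex.I * t j) - 1) * μ.real (A j)))) := by
    simp_rw [hpart]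
    refine (Complex.continuous_exp.tendsto _).comp (HasSum.tendsto_sum_nat ?_)
    exact hasSum_sum fun j _ => (Complex.hasSum_ofReal.2 (hreal j)).mul_left _
  have hlim2 : Filter.Tendsto (fun M : ℕ => ∫ ω, ∏ n ∈ Finset.range M, expCount A t (ω n) ∂Q)
      Filter.atTop (nhds (∫ ω, expCount A t (superpose ω) ∂Q)) := by
    refine tendsto_integral_of_dominated_convergence (fun _ => 1) (fun M => ?_)
      (integrable_const _) (fun M => ae_of_all _ fun ω => ?_) ?_
    · exact (Finset.measurable_fun_prod _ fun n _ =>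
        (measurable_expCount hA t).comp (measurable_pi_apply n)).aestronglyMeasurable
    · rw [norm_prod]
      simp [norm_expCount]
    · filter_upwards [hae] with ω hω
      simp_rw [expCount, ← Complex.exp_sum, ← Finset.mul_sum, ← Complex.ofReal_sum]
      refine (Complex.continuous_exp.tendsto _).comp (Filter.Tendsto.const_mul _
        ((Complex.continuous_ofReal.tendsto _).comp (HasSum.tendsto_sum_nat ?_)))
      refine hasSum_sum fun j _ => HasSum.mul_left _ ?_
      have : (superpose ω).1 (A j) = ∑' n, (ω n).1 (A j) := Measure.sum_apply _ (hA j)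
      rw [this, ENNReal.tsum_toReal_eq (fun n => ENNReal.ne_top_of_tsum_ne_top (hω j) n)]
      exact (ENNReal.summable_toReal (hω j)).hasSum
  rw [poissonLaw, integral_map measurable_superpose.aemeasurable
    (measurable_expCount hA t).aestronglyMeasurable]
  exact tendsto_nhds_unique hlim2 hlim1

theorem ae_count_ne_top {X : Type*} [MeasurableSpace X] (μ : Measure X) [SFinite μ]
    {A : Set X} (hA : MeasurableSet A) (hfin : μ A ≠ ∞) :
    ∀ᵐ ω ∂(poissonLaw μ), ω.1 A ≠ ∞ := by
  refine (ae_lt_top (measurable_count hA) ?_).mono fun _ h => h.ne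
  rw [poissonLaw, lintegral_map (measurable_count hA) measurable_superpose]
  have hm : ∀ n, Measurable fun ω : ℕ → Config X => (ω n).1 A :=
      fun n => (measurable_count hA).comp (measurable_pi_apply n)
  have h1 : ∀ ω : ℕ → Config X, (superpose ω).1 A = ∑' n, (ω n).1 A :=
    fun ω => Measure.sum_apply _ hA
  simp_rw [h1]
  rw [lintegral_tsum fun n => (hm n).aemeasurable]
  have : ∀ n, ∫⁻ ω, (ω n).1 A ∂(Measure.infinitePi fun n => finitePoisson (sfiniteSeq μ n))
      = sfiniteSeq μ n A := fun n => by
    rw [← lintegral_count (sfiniteSeq μ n) hA,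
      ← Measure.infinitePi_map_eval (fun n => finitePoisson (sfiniteSeq μ n)) n,
      lintegral_map (measurable_count hA) (measurable_pi_apply n)]
  simp_rw [this]
  rw [← Measure.sum_apply _ hA, sum_sfiniteSeq]
  exact hfin

instance {X : Type*} [MeasurableSpace X] (μ : Measure X) [SFinite μ] :
    IsProbabilityMeasure (poissonLaw μ) :=
  Measure.isProbabilityMeasure_map measurable_superpose.aemeasurable

theorem map_toReal_count {X : Type*} [MeasurableSpace X] (μ : Measure X) [SFinite μ]
    {A : Set X} (hA : MeasurableSet A) (hfin : μ A ≠ ∞) :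
    (poissonLaw μ).map (fun ω => (ω.1 A).toReal) =
      (poissonMeasure (μ A).toNNReal).map (fun n : ℕ => (n : ℝ)) := by
  have hm := (measurable_count hA).ennreal_toReal
  have := Measure.isProbabilityMeasure_map (μ := poissonLaw μ) hm.aemeasurable
  have := Measure.isProbabilityMeasure_map (μ := poissonMeasure (μ A).toNNReal)
    (f := fun n : ℕ => (n : ℝ)) Measurable.of_discrete.aemeasurable
  refine Measure.ext_of_charFun (funext fun t => ?_)
  rw [charFun_map_cast_poissonMeasure, charFun_apply,
    integral_map hm.aemeasurable (by fun_prop)]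
  have := integral_expCount (ι := Unit) (A := fun _ => A) (fun _ => hA)
    (fun i j h => (h rfl).elim) (fun _ => t) μ (fun _ => hfin)
  simp only [expCount, Finset.univ_unique, Finset.sum_singleton] at this
  convert this using 2
  · ext ω
    congr 1
    rw [Real.inner_apply]
    push_cast
    ring
  · rw [mul_comm Complex.I, mul_comm]
    rfl

/-- The measure `poissonLaw μ` is the law of the Poisson process of intensity `μ`. -/
theorem isPoissonLaw_poissonLaw {X : Type*} [MeasurableSpace X] (μ : Measure X) [SFinite μ] :
    IsPoissonLaw μ (poissonLaw μ) where
  isProbabilityMeasure := inferInstance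
  map_count A hA hfin := by
    have h1 : (fun ω : Config X => ω.1 A) =ᵐ[poissonLaw μ]
        ENNReal.ofReal ∘ (fun ω : Config X => (ω.1 A).toReal) := by
      filter_upwards [ae_count_ne_top μ hA hfin] with ω hω
      simp [ENNReal.ofReal_toReal hω]
    rw [Measure.map_congr h1, ← Measure.map_map ENNReal.measurable_ofReal
      (measurable_count hA).ennreal_toReal, map_toReal_count μ hA hfin,
      Measure.map_map ENNReal.measurable_ofReal Measurable.of_discrete]
    congr 1
    ext n
    simp
  indep_count A hA hfin hd := by
    have hreal : iIndepFun (fun (n : ℕ) (ω : Config X) => (ω.1 (A n)).toReal) (poissonLaw μ) := by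
      rw [iIndepFun_iff_finset]
      intro s
      have hm : ∀ i : s, Measurable (fun ω : Config X => (ω.1 (A i)).toReal) :=
        fun i => (measurable_count (hA i)).ennreal_toReal
      refine (iIndepFun_iff_charFun_pi fun i => (hm i).aemeasurable).2 fun t => ?_
      have hj := integral_expCount (A := fun i : s => A i) (fun i => hA i)
        (fun i j hij => hd fun h => hij (Subtype.ext h)) t μ (fun i => hfin i)
      have hm' : Measurable (fun (ω : Config X) => WithLp.toLp 2
          (fun i : s => (ω.1 (A i)).toReal)) :=
        (WithLp.measurable_toLp 2 _).comp (measurable_pi_lambda _ hm)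
      refine (charFun_apply t).trans ?_
      refine (integral_map hm'.aemeasurable (by fun_prop)).trans ?_
      have h1 : ∀ i : s, charFun ((poissonLaw μ).map (s.restrict
          (fun (n : ℕ) (ω : Config X) => (ω.1 (A n)).toReal) i)) (t i) =
          Complex.exp ((Complex.exp (Complex.I * t i) - 1) * μ.real (A i)) := fun i => by
        refine (congrArg (fun m => charFun m (t i))
          (map_toReal_count μ (hA i) (hfin i))).trans ?_
        rw [charFun_map_cast_poissonMeasure, mul_comm, mul_comm Complex.I]
        rfl
      refine Eq.trans ?_ (Finset.prod_congr rfl fun i _ => h1 i).symm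
      rw [← Complex.exp_sum, ← hj]
      congr 1
      ext ω
      simp only [expCount, PiLp.inner_apply, Real.inner_apply]
      rw [mul_comm Complex.I]
      congr 4 with i
      ring
    refine (hreal.comp (fun _ => ENNReal.ofReal) fun _ => ENNReal.measurable_ofReal).congr
      fun n => ?_
    filter_upwards [ae_count_ne_top μ (hA n) (hfin n)] with ω hω
    simp [ENNReal.ofReal_toReal hω]

end PoissonSuspension

end

/-! Write `r` for `T'`. Nonsingularity rests on superposition: a Poisson process of intensity `κ +
m` is the union of independent Poisson processes of intensities `κ` and `m`. Since `r - 1` is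
integrable, `μ` and `μ ∘ T⁻¹` can be written `κ + m₂` and `κ + m₁` with `m₁`, `m₂` finite and
equivalent. Finite Poisson laws with equivalent intensities are equivalent, and adding an
independent process of intensity `κ` preserves this (`HasPoissonLaplace.absolutelyContinuous`). The
laws are identified through their Laplace functionals, which determine them
(`HasPoissonLaplace.unique`).

Dissipativity comes from a drift. The signed measure `μ ∘ T⁻¹ - μ` vanishes on the part of `X` swept
out by points that are recurrent in both directions, so if `χ(T) ≠ 0` it charges the saturation of a
wandering set `W` of finite measure (`exists_wandering`). There its mass telescopes to `l₂ - l₁`,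
the difference of the limits of `μ (Tⁿ W)` at `-∞` and `+∞`; hence `l₁ ≠ l₂`.

For almost every `ω` the counts `ω (Tⁿ W)` average to `l₁` in the future and to `l₂` in the past
(`tendsto_sum_count`). Subtract the midpoint of `l₁` and `l₂`, choose the sign, and sum: the
resulting two-sided walk tends to `-∞` at both ends. It has a unique first time of maximum, and the
suspension moves that time by one. The configurations whose maximum is first taken at time `0` form
the required set. -/

noncomputable section

namespace PoissonSuspension

open MeasureTheory ProbabilityTheory Filter Topology
open scoped ENNReal NNReal

variable {X : Type*} [MeasurableSpace X]

/-! ### Laplace functionals of Poisson processes -/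

/-- The function `t ↦ e^{-t}` on `[0, ∞]`, with `e^{-∞} = 0`. -/
def expNeg (t : ℝ≥0∞) : ℝ := (EReal.exp (-(t : EReal))).toReal

theorem exp_neg_coe_le_one (t : ℝ≥0∞) : EReal.exp (-(t : EReal)) ≤ 1 := by
  rw [EReal.exp_le_one_iff, EReal.neg_le_zero]
  exact EReal.coe_ennreal_nonneg t

theorem expNeg_nonneg (t : ℝ≥0∞) : 0 ≤ expNeg t := ENNReal.toReal_nonneg

theorem expNeg_le_one (t : ℝ≥0∞) : expNeg t ≤ 1 :=
  ENNReal.toReal_le_of_le_ofReal zero_le_one (by simpa using exp_neg_coe_le_one t)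

theorem norm_expNeg_le_one (t : ℝ≥0∞) : ‖expNeg t‖ ≤ 1 := by
  rw [Real.norm_of_nonneg (expNeg_nonneg t)]
  exact expNeg_le_one t

theorem expNeg_zero : expNeg 0 = 1 := by simp [expNeg]

theorem expNeg_add (s t : ℝ≥0∞) : expNeg (s + t) = expNeg s * expNeg t := by
  rw [expNeg, expNeg, expNeg, ← ENNReal.toReal_mul, ← EReal.exp_add, EReal.coe_ennreal_add,
    EReal.neg_add (by simp) (by simp), sub_eq_add_neg]

theorem expNeg_ofReal {x : ℝ} (hx : 0 ≤ x) : expNeg (ENNReal.ofReal x) = Real.exp (-x) := by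
  rw [expNeg, EReal.coe_ennreal_ofReal, max_eq_left hx, ← EReal.coe_neg, EReal.exp_coe,
    ENNReal.toReal_ofReal (Real.exp_pos _).le]

theorem expNeg_injective : Function.Injective expNeg := by
  intro s t h
  have h1 := (ENNReal.toReal_eq_toReal_iff' ((exp_neg_coe_le_one s).trans_lt ENNReal.one_lt_top).ne
    ((exp_neg_coe_le_one t).trans_lt ENNReal.one_lt_top).ne).1 h
  simpa using EReal.exp_strictMono.injective h1

theorem continuous_expNeg : Continuous expNeg := by
  refine continuous_iff_continuousAt.2 fun t => ?_
  refine (ENNReal.tendsto_toReal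
    ((exp_neg_coe_le_one t).trans_lt ENNReal.one_lt_top).ne).comp ?_
  exact (ENNReal.continuous_exp.comp
    (continuous_neg.comp continuous_coe_ennreal_ereal)).continuousAt

theorem measurable_expNeg : Measurable expNeg := continuous_expNeg.measurable

theorem measurableEmbedding_expNeg : MeasurableEmbedding expNeg :=
  measurable_expNeg.measurableEmbedding expNeg_injective

theorem expNeg_sum {ι : Type*} (s : Finset ι) (t : ι → ℝ≥0∞) :
    expNeg (∑ i ∈ s, t i) = ∏ i ∈ s, expNeg (t i) := by
  classical
  induction s using Finset.induction_on with
  | empty => simp [expNeg_zero]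
  | insert i s hi ih => rw [Finset.sum_insert hi, Finset.prod_insert hi, expNeg_add, ih]

theorem tendsto_prod_expNeg (t : ℕ → ℝ≥0∞) :
    Tendsto (fun M => ∏ n ∈ Finset.range M, expNeg (t n)) atTop (𝓝 (expNeg (∑' n, t n))) := by
  simp_rw [← expNeg_sum]
  exact (continuous_expNeg.tendsto _).comp (ENNReal.tendsto_nat_tsum t)

/-- The law `P` has the Laplace functional of a Poisson process of intensity `μ`. -/
def HasPoissonLaplace (P : Measure (Config X)) (μ : Measure X) : Prop :=
  ∀ g : X → ℝ≥0∞, Measurable g →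
    ∫ ω, expNeg (∫⁻ x, g x ∂ω.1) ∂P = expNeg (∫⁻ x, ENNReal.ofReal (1 - expNeg (g x)) ∂μ)

theorem measurable_lintegral_config {g : X → ℝ≥0∞} (hg : Measurable g) :
    Measurable fun ω : Config X => ∫⁻ x, g x ∂ω.1 :=
  (Measure.measurable_lintegral hg).comp measurable_subtype_coe

theorem measurable_expNeg_lintegral {g : X → ℝ≥0∞} (hg : Measurable g) :
    Measurable fun ω : Config X => expNeg (∫⁻ x, g x ∂ω.1) :=
  measurable_expNeg.comp (measurable_lintegral_config hg)

theorem lintegral_pts (k : ℕ) (x : Fin k → X) {g : X → ℝ≥0∞} (hg : Measurable g) :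
    ∫⁻ y, g y ∂(pts k x).1 = ∑ i, g (x i) := by
  rw [pts, lintegral_sum_measure, tsum_fintype]
  simp_rw [lintegral_dirac' _ hg]

/-- The functional `ω ↦ e^{-∫ g dω}` is multiplicative over the points of `ω`, so
`integral_finitePoisson` applies with `f = e^{-g}`, and the exponent `∫ f dm - m(X)` equals `-∫ (1 -
e^{-g}) dm`. -/
theorem hasPoissonLaplace_finitePoisson (m : Measure X) [IsFiniteMeasure m] :
    HasPoissonLaplace (finitePoisson m) m := by
  intro g hg
  have hr : Integrable (fun x => expNeg (g x)) m :=
    Integrable.of_bound (measurable_expNeg.comp hg).aestronglyMeasurable 1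
      (ae_of_all _ fun x => norm_expNeg_le_one _)
  have h := integral_finitePoisson m
    (F := fun ω => ((expNeg (∫⁻ x, g x ∂ω.1) : ℝ) : ℂ))
    (Complex.measurable_ofReal.comp (measurable_expNeg_lintegral hg))
    (fun ω => by rw [Complex.norm_real]; exact norm_expNeg_le_one _)
    (f := fun x => ((expNeg (g x) : ℝ) : ℂ)) (fun k x => by
      rw [lintegral_pts k x hg, expNeg_sum]
      push_cast
      rfl)
  rw [integral_complex_ofReal, integral_complex_ofReal, ← Complex.ofReal_sub, ← Complex.ofReal_exp,
    Complex.ofReal_inj] at h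
  have h2 : Integrable (fun x => 1 - expNeg (g x)) m := (integrable_const 1).sub hr
  rw [h, ← ofReal_integral_eq_lintegral_ofReal h2
    (ae_of_all _ fun x => sub_nonneg.2 (expNeg_le_one _)),
    expNeg_ofReal (integral_nonneg fun x => sub_nonneg.2 (expNeg_le_one _)),
    integral_sub (integrable_const 1) hr, integral_const, smul_eq_mul, mul_one, neg_sub]

/-- Independence handles finite products over the pieces of `μ`. The passage to infinitely many
pieces needs no finiteness of `∫ g dω`, because `expNeg` is continuous on all of `[0, ∞]` and
bounded by `1`. -/
theorem hasPoissonLaplace_poissonLaw (μ : Measure X) [SFinite μ] :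
    HasPoissonLaplace (poissonLaw μ) μ := by
  intro g hg
  set Q := Measure.infinitePi fun n => finitePoisson (sfiniteSeq μ n) with hQ
  have hmeas := measurable_expNeg_lintegral hg
  have hpart : ∀ M : ℕ, ∫ ω, ∏ n ∈ Finset.range M, expNeg (∫⁻ x, g x ∂(ω n).1) ∂Q =
      ∏ n ∈ Finset.range M,
        expNeg (∫⁻ x, ENNReal.ofReal (1 - expNeg (g x)) ∂(sfiniteSeq μ n)) := by
    intro M
    have hind : iIndepFun (fun (n : ℕ) (ω : ℕ → Config X) => expNeg (∫⁻ x, g x ∂(ω n).1)) Q :=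
      iIndepFun_infinitePi (X := fun _ (ω : Config X) => expNeg (∫⁻ x, g x ∂ω.1)) fun _ => hmeas
    have hind' := hind.precomp (g := fun i : Fin M => (i : ℕ)) Fin.val_injective
    have := hind'.integral_fun_prod_eq_prod_integral fun i =>
      (hmeas.comp (measurable_pi_apply _)).aestronglyMeasurable
    simp_rw [Finset.prod_range]
    refine this.trans (Finset.prod_congr rfl fun i _ => ?_)
    rw [← hasPoissonLaplace_finitePoisson (sfiniteSeq μ i) g hg,
      ← Measure.infinitePi_map_eval (fun n => finitePoisson (sfiniteSeq μ n)) (i : ℕ),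
      integral_map (measurable_pi_apply _).aemeasurable hmeas.aestronglyMeasurable]
  have hlim1 := tendsto_prod_expNeg fun n =>
    ∫⁻ x, ENNReal.ofReal (1 - expNeg (g x)) ∂(sfiniteSeq μ n)
  rw [← lintegral_sum_measure, sum_sfiniteSeq] at hlim1
  have hlim2 : Tendsto (fun M : ℕ => ∫ ω, ∏ n ∈ Finset.range M, expNeg (∫⁻ x, g x ∂(ω n).1) ∂Q)
      atTop (𝓝 (∫ ω, expNeg (∫⁻ x, g x ∂(superpose ω).1) ∂Q)) := by
    refine tendsto_integral_of_dominated_convergence (fun _ => 1) (fun M => ?_)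
      (integrable_const _) (fun M => ae_of_all _ fun ω => ?_) (ae_of_all _ fun ω => ?_)
    · exact (Finset.measurable_fun_prod _ fun n _ =>
        hmeas.comp (measurable_pi_apply n)).aestronglyMeasurable
    · rw [← expNeg_sum]
      exact norm_expNeg_le_one _
    · rw [superpose, lintegral_sum_measure]
      exact tendsto_prod_expNeg _
  simp_rw [hpart] at hlim2
  rw [poissonLaw, integral_map measurable_superpose.aemeasurable hmeas.aestronglyMeasurable]
  exact tendsto_nhds_unique hlim2 hlim1

theorem HasPoissonLaplace.map_suspension {P : Measure (Config X)} {μ : Measure X}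
    (h : HasPoissonLaplace P μ) (T : X ≃ᵐ X) :
    HasPoissonLaplace (P.map (suspension T)) (μ.map T) := by
  intro g hg
  rw [(suspension T).measurableEmbedding.integral_map, T.measurableEmbedding.lintegral_map]
  have := h (fun x => g (T x)) (hg.comp T.measurable)
  rw [← this]
  refine integral_congr_ae (ae_of_all _ fun ω => ?_)
  exact congrArg expNeg (T.measurableEmbedding.lintegral_map _)

theorem IsCounting.add {ω₁ ω₂ : Measure X} (h₁ : IsCounting ω₁) (h₂ : IsCounting ω₂) :
    IsCounting (ω₁ + ω₂) := by
  obtain ⟨ι₁, _, x₁, rfl⟩ := h₁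
  obtain ⟨ι₂, _, x₂, rfl⟩ := h₂
  refine ⟨ι₁ ⊕ ι₂, inferInstance, Sum.elim x₁ x₂, ?_⟩
  ext A hA
  rw [Measure.add_apply, Measure.sum_apply _ hA, Measure.sum_apply _ hA, Measure.sum_apply _ hA,
    ENNReal.summable.tsum_sum ENNReal.summable]
  simp

/-- Superposition of two configurations. -/
def addConfig (ω : Config X × Config X) : Config X :=
  ⟨ω.1.1 + ω.2.1, ω.1.2.add ω.2.2⟩

theorem measurable_addConfig : Measurable (addConfig (X := X)) := by
  refine Measurable.subtype_mk (Measure.measurable_of_measurable_coe _ fun A hA => ?_)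
  simp only [Measure.add_apply]
  exact ((measurable_count hA).comp measurable_fst).add ((measurable_count hA).comp measurable_snd)

theorem HasPoissonLaplace.superposition {P Q : Measure (Config X)} {μ ν : Measure X}
    [SFinite P] [SFinite Q] (hP : HasPoissonLaplace P μ) (hQ : HasPoissonLaplace Q ν) :
    HasPoissonLaplace ((P.prod Q).map addConfig) (μ + ν) := by
  intro g hg
  rw [integral_map measurable_addConfig.aemeasurable
    (measurable_expNeg_lintegral hg).aestronglyMeasurable, lintegral_add_measure, expNeg_add,
    ← hP g hg, ← hQ g hg, ← integral_prod_mul]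
  simp only [addConfig, lintegral_add_measure, expNeg_add]

/-! ### A law is determined by its Laplace functional -/

/-- The counts, in the coordinates `e^{-t}`, of all measurable sets. -/
def expCounts (ω : Config X) (A : {A : Set X // MeasurableSet A}) : unitInterval :=
  ⟨expNeg (ω.1 A), expNeg_nonneg _, expNeg_le_one _⟩

theorem measurable_expCounts : Measurable (expCounts (X := X)) :=
  measurable_pi_lambda _ fun A =>
    (measurable_expNeg.comp (measurable_count A.2)).subtype_mk

theorem comap_expCounts :
    (MeasurableSpace.pi.comap (expCounts (X := X))) = (inferInstance : MeasurableSpace (Config X)) := by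
  refine le_antisymm measurable_expCounts.comap_le ?_
  have key : @Measurable (Config X) (Measure X) (MeasurableSpace.pi.comap expCounts) _
      Subtype.val := by
    refine @Measure.measurable_of_measurable_coe _ _ _ (MeasurableSpace.pi.comap expCounts) _
      fun A hA => ?_
    have h := measurable_subtype_coe.comp ((measurable_pi_apply
      (⟨A, hA⟩ : {A : Set X // MeasurableSet A})).comp (comap_measurable (expCounts (X := X))))
    exact (measurableEmbedding_expNeg.measurable_comp_iff
      (mα := MeasurableSpace.pi.comap expCounts)).1 h
  exact key.comap_le

/-- The coordinates separate the points of the compact cube, and the algebra they generate is the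
linear span of the monomials. -/
theorem measure_ext_of_integral_monomials {ι : Type*} [Fintype ι]
    {P Q : Measure (ι → unitInterval)} [IsFiniteMeasure P] [IsFiniteMeasure Q]
    (h : ∀ n : ι → ℕ, ∫ y, ∏ i, (y i : ℝ) ^ n i ∂P = ∫ y, ∏ i, (y i : ℝ) ^ n i ∂Q) : P = Q := by
  let coord : ι → BoundedContinuousFunction (ι → unitInterval) ℝ := fun i =>
    BoundedContinuousFunction.mkOfCompact
      ⟨fun y => (y i : ℝ), continuous_subtype_val.comp (continuous_apply i)⟩
  let A : StarSubalgebra ℝ (BoundedContinuousFunction (ι → unitInterval) ℝ) :=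
    { Algebra.adjoin ℝ (Set.range coord) with
      star_mem' := fun {f} hf => by
        have : star f = f := by ext y; simp
        rw [this]
        exact hf }
  refine ext_of_forall_mem_subalgebra_integral_eq_of_polish (𝕜 := ℝ) (A := A) ?_ ?_
  · intro y z hyz
    obtain ⟨i, hi⟩ := Function.ne_iff.1 hyz
    refine ⟨_, ⟨(coord i).toContinuousMap, ⟨coord i, Algebra.subset_adjoin ⟨i, rfl⟩, rfl⟩, rfl⟩, ?_⟩
    exact fun h => hi (Subtype.ext h)
  · intro f hf
    have hf' : f ∈ Submodule.span ℝ (Submonoid.closure (Set.range coord) :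
        Set (BoundedContinuousFunction (ι → unitInterval) ℝ)) := by
      rw [← Algebra.adjoin_eq_span]
      exact hf
    clear hf
    induction hf' using Submodule.span_induction with
    | mem f hf =>
      have : ∃ n : ι → ℕ, ∀ y, f y = ∏ i, (y i : ℝ) ^ n i := by
        induction hf using Submonoid.closure_induction with
        | mem f hf =>
          classical
          obtain ⟨i, rfl⟩ := hf
          refine ⟨Pi.single i 1, fun y => ?_⟩
          rw [Finset.prod_eq_single i (fun j _ hj => by simp [hj]) (by simp)]
          simp [coord]
        | one => exact ⟨0, fun y => by simp⟩
        | mul f g _ _ hf hg =>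
          obtain ⟨n, hn⟩ := hf
          obtain ⟨k, hk⟩ := hg
          exact ⟨n + k, fun y => by simp [hn, hk, pow_add, Finset.prod_mul_distrib]⟩
      obtain ⟨n, hn⟩ := this
      simp_rw [hn]
      exact h n
    | zero => simp
    | add f g hf hg ihf ihg =>
      simp only [BoundedContinuousFunction.coe_add, Pi.add_apply]
      rw [integral_add (f.integrable _) (g.integrable _),
        integral_add (f.integrable _) (g.integrable _), ihf, ihg]
    | smul c f hf ih =>
      simp only [BoundedContinuousFunction.coe_smul]
      rw [integral_smul, integral_smul, ih]

/-- A monomial in the coordinates `e^{-ω(A)}` is again of the form `e^{-∫ g dω}`, with `g` a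
combination of indicators with natural coefficients. So the Laplace functional fixes all
finite-dimensional marginals of the image under `expCounts`, and the σ-algebra of `Config X` is
pulled back along that map. The sets `A` need be neither disjoint nor of finite measure. -/
theorem HasPoissonLaplace.unique {P Q : Measure (Config X)} {μ : Measure X}
    [IsProbabilityMeasure P] [IsProbabilityMeasure Q]
    (hP : HasPoissonLaplace P μ) (hQ : HasPoissonLaplace Q μ) : P = Q := by
  have hmap : P.map expCounts = Q.map expCounts := by
    have hfin : ∀ (I : Finset {A : Set X // MeasurableSet A}) (R : Measure (Config X))
        [IsProbabilityMeasure R] (n : I → ℕ), HasPoissonLaplace R μ →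
        ∫ y, ∏ i, (y i : ℝ) ^ n i ∂((R.map expCounts).map I.restrict) =
          expNeg (∫⁻ x, ENNReal.ofReal (1 - expNeg
            (∑ i, n i * (i.1.1).indicator (fun _ => (1 : ℝ≥0∞)) x)) ∂μ) := by
      intro I R _ n hR
      have hg : ∀ i : I, Measurable ((i.1.1).indicator (fun _ : X => (1 : ℝ≥0∞))) :=
        fun i => measurable_const.indicator i.1.2
      have hmon : Measurable fun y : I → unitInterval => ∏ i, (y i : ℝ) ^ n i :=
        Finset.measurable_fun_prod _ fun i _ => (measurable_subtype_coe.comp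
          (measurable_pi_apply i)).pow_const _
      rw [Measure.map_map (Finset.measurable_restrict I) measurable_expCounts,
        integral_map ((Finset.measurable_restrict I).comp measurable_expCounts).aemeasurable
          hmon.aestronglyMeasurable,
        ← hR _ (Finset.measurable_fun_sum _ fun i _ => (hg i).const_mul _)]
      refine integral_congr_ae (ae_of_all _ fun ω => ?_)
      simp only
      rw [lintegral_finsetSum _ fun i _ => (hg i).const_mul _, expNeg_sum]
      refine Finset.prod_congr rfl fun i _ => ?_
      rw [lintegral_const_mul _ (hg i), lintegral_indicator_const i.1.2, one_mul,
        ← nsmul_eq_mul, ← Fin.sum_const, expNeg_sum, Fin.prod_const]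
      rfl
    have : ∀ I : Finset {A : Set X // MeasurableSet A},
        (P.map expCounts).map I.restrict = (Q.map expCounts).map I.restrict := by
      intro I
      have := Measure.isProbabilityMeasure_map (μ := P) measurable_expCounts.aemeasurable
      have := Measure.isProbabilityMeasure_map (μ := Q) measurable_expCounts.aemeasurable
      have := Measure.isProbabilityMeasure_map (μ := P.map expCounts)
        (Finset.measurable_restrict I).aemeasurable
      have := Measure.isProbabilityMeasure_map (μ := Q.map expCounts)
        (Finset.measurable_restrict I).aemeasurable
      refine measure_ext_of_integral_monomials fun n => ?_
      rw [hfin I P n hP, hfin I Q n hQ]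
    have h1 : ∀ I : Finset {A : Set X // MeasurableSet A},
        IsFiniteMeasure ((Q.map expCounts).map I.restrict) := fun I => inferInstance
    exact IsProjectiveLimit.unique (P := fun I => (Q.map expCounts).map I.restrict) this
      fun I => rfl
  ext s hs
  obtain ⟨t, ht, rfl⟩ := (comap_expCounts (X := X)).ge s hs
  rw [← Measure.map_apply measurable_expCounts ht, hmap, Measure.map_apply measurable_expCounts ht]

/-! ### Nonsingularity of the suspension -/

theorem pi_absolutelyContinuous_pi {m₁ m₂ : Measure X} [SigmaFinite m₁] [SigmaFinite m₂]
    (h : m₁ ≪ m₂) (k : ℕ) :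
    Measure.pi (fun _ : Fin k => m₁) ≪ Measure.pi (fun _ : Fin k => m₂) := by
  induction k with
  | zero => rw [Measure.pi_of_empty, Measure.pi_of_empty]
  | succ k ih =>
    have h₁ := (measurePreserving_piFinSuccAbove (fun _ : Fin (k + 1) => m₁) 0).symm
    have h₂ := (measurePreserving_piFinSuccAbove (fun _ : Fin (k + 1) => m₂) 0).symm
    rw [← h₁.map_eq, ← h₂.map_eq]
    exact (h.prod ih).map h₁.measurable

/-- The comparison is made separately for each number of points; every weight in the target is
strictly positive. -/
theorem finitePoisson_absolutelyContinuous {m₁ m₂ : Measure X} [IsFiniteMeasure m₁]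
    [IsFiniteMeasure m₂] (h : m₁ ≪ m₂) : finitePoisson m₁ ≪ finitePoisson m₂ := by
  refine Measure.absolutelyContinuous_sum_left fun k => ?_
  refine Measure.AbsolutelyContinuous.trans ?_ (Measure.absolutelyContinuous_sum_right k
    (Measure.AbsolutelyContinuous.rfl))
  refine Measure.AbsolutelyContinuous.trans (Measure.smul_absolutelyContinuous)
    (Measure.AbsolutelyContinuous.trans
      ((pi_absolutelyContinuous_pi h k).map (measurable_pts k)) ?_)
  refine Measure.absolutelyContinuous_smul ?_
  simp only [ne_eq, ENNReal.ofReal_eq_zero, not_le]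
  positivity

/-- By uniqueness both laws are images, under the same superposition map, of product measures that
share the factor `poissonLaw κ`. -/
theorem HasPoissonLaplace.absolutelyContinuous {P Q : Measure (Config X)} {κ m₁ m₂ : Measure X}
    [IsProbabilityMeasure P] [IsProbabilityMeasure Q] [SFinite κ] [IsFiniteMeasure m₁]
    [IsFiniteMeasure m₂] (hP : HasPoissonLaplace P (κ + m₁)) (hQ : HasPoissonLaplace Q (κ + m₂))
    (h : m₁ ≪ m₂) : P ≪ Q := by
  have h₁ := (hasPoissonLaplace_poissonLaw κ).superposition (hasPoissonLaplace_finitePoisson m₁)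
  have h₂ := (hasPoissonLaplace_poissonLaw κ).superposition (hasPoissonLaplace_finitePoisson m₂)
  have := Measure.isProbabilityMeasure_map
    (μ := (poissonLaw κ).prod (finitePoisson m₁)) measurable_addConfig.aemeasurable
  have := Measure.isProbabilityMeasure_map
    (μ := (poissonLaw κ).prod (finitePoisson m₂)) measurable_addConfig.aemeasurable
  rw [hP.unique h₁, hQ.unique h₂]
  exact (Measure.AbsolutelyContinuous.rfl.prod (finitePoisson_absolutelyContinuous h)).map
    measurable_addConfig

theorem withDensity_absolutelyContinuous_withDensity {μ : Measure X} {p q : X → ℝ≥0∞}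
    (hp : Measurable p) (hq : Measurable q) (h : ∀ᵐ x ∂μ, q x = 0 → p x = 0) :
    μ.withDensity p ≪ μ.withDensity q := by
  refine Measure.AbsolutelyContinuous.mk fun s hs h0 => ?_
  rw [withDensity_apply _ hs, lintegral_eq_zero_iff hq] at h0
  rw [withDensity_apply _ hs, lintegral_eq_zero_iff hp]
  filter_upwards [h0, ae_restrict_of_ae h] with x hx hx' using hx' hx

theorem measurable_rnDer (μ : Measure X) (T : X ≃ᵐ X) : Measurable (rnDer μ T) :=
  (Measure.measurable_rnDeriv _ _).ennreal_toReal

theorem rnDer_nonneg (μ : Measure X) (T : X ≃ᵐ X) (x : X) : 0 ≤ rnDer μ T x :=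
  ENNReal.toReal_nonneg

theorem withDensity_rnDer {μ : Measure X} [SigmaFinite μ] {T : X ≃ᵐ X} (hT : IsNonsingular μ T) :
    μ.withDensity (fun x => ENNReal.ofReal (rnDer μ T x)) = μ.map T := by
  have := T.sigmaFinite_map (μ := μ)
  rw [← Measure.withDensity_rnDeriv_eq _ _ hT.1]
  refine withDensity_congr_ae ?_
  filter_upwards [Measure.rnDeriv_ne_top (μ.map T) μ] with x hx
  exact ENNReal.ofReal_toReal hx

theorem rnDer_pos {μ : Measure X} [SigmaFinite μ] {T : X ≃ᵐ X} (hT : IsNonsingular μ T) :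
    ∀ᵐ x ∂μ, 0 < rnDer μ T x := by
  have := T.sigmaFinite_map (μ := μ)
  filter_upwards [Measure.rnDeriv_ne_top (μ.map T) μ, Measure.rnDeriv_pos' hT.2] with x hx hx'
  exact ENNReal.toReal_pos hx'.ne' hx

theorem isFiniteMeasure_withDensity_of_le {μ : Measure X} {f g : X → ℝ} (hg : Integrable g μ)
    (h : ∀ x, f x ≤ 2 * |g x|) :
    IsFiniteMeasure (μ.withDensity fun x => ENNReal.ofReal (f x)) := by
  refine isFiniteMeasure_withDensity (((lintegral_mono fun x =>
    ENNReal.ofReal_le_ofReal (h x)).trans_lt ?_).ne)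
  exact Integrable.lintegral_lt_top (hg.abs.const_mul 2)

/-- Taking `min 1 r` as the common density would leave the remainders `(r - 1)⁺` and `(1 - r)⁺`,
which are mutually singular. Removing a further `|r - 1|` makes both remainders positive wherever `r
≠ 1` and `r > 0`, and they stay integrable, being at most `2 |r - 1|`. -/
theorem isNonsingular_suspension {μ : Measure X} [SigmaFinite μ] {T : X ≃ᵐ X} (hT : MemAut₁ μ T) :
    IsNonsingular (poissonLaw μ) (suspension T) := by
  set r := rnDer μ T
  have hr : Measurable r := measurable_rnDer μ T
  -- The part of the intensity that is common to `μ` and `μ ∘ T⁻¹`.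
  let k : X → ℝ := fun x => max 0 (min 1 (r x) - |r x - 1|)
  have hk : Measurable k := by
    have : Measurable fun x => |r x - 1| := (hr.sub_const 1).abs
    exact measurable_const.max ((measurable_const.min hr).sub this)
  have hr0 : ∀ x, 0 ≤ r x := rnDer_nonneg μ T
  have hk0 : ∀ x, 0 ≤ k x := fun x => le_max_left _ _
  -- The last clause needs `0 < r x`: at `r x = 0` one has `k x = 0`, so `r - k` vanishes while `1 -
  -- k` does not. Nonsingularity of `T` excludes this almost everywhere.
  have hcases : ∀ x, (k x ≤ 1 ∧ k x ≤ r x) ∧ (1 - k x ≤ 2 * |r x - 1| ∧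
      r x - k x ≤ 2 * |r x - 1|) ∧ (0 < r x → (r x - k x ≤ 0 ↔ 1 - k x ≤ 0)) := by
    intro x
    have := hr0 x
    simp only [k]
    rcases le_total 1 (r x) with h | h
    · rw [min_eq_left h, abs_of_nonneg (by linarith)]
      rcases max_cases 0 (1 - (r x - 1)) with ⟨h1, h2⟩ | ⟨h1, h2⟩ <;> rw [h1] <;> grind
    · rw [min_eq_right h, abs_of_nonpos (by linarith)]
      rcases max_cases 0 (r x - -(r x - 1)) with ⟨h1, h2⟩ | ⟨h1, h2⟩ <;> rw [h1] <;> grind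
  let κ := μ.withDensity fun x => ENNReal.ofReal (k x)
  let m₁ := μ.withDensity fun x => ENNReal.ofReal (r x - k x)
  let m₂ := μ.withDensity fun x => ENNReal.ofReal (1 - k x)
  have : IsFiniteMeasure m₁ := isFiniteMeasure_withDensity_of_le hT.2 fun x => (hcases x).2.1.2
  have : IsFiniteMeasure m₂ := isFiniteMeasure_withDensity_of_le hT.2 fun x => (hcases x).2.1.1
  have h₁ : κ + m₁ = μ.map T := by
    rw [← withDensity_rnDer hT.1, ← withDensity_add_left hk.ennreal_ofReal]
    congr 1
    ext x
    rw [Pi.add_apply, ← ENNReal.ofReal_add (hk0 x) (sub_nonneg.2 (hcases x).1.2),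
      add_sub_cancel]
  have h₂ : κ + m₂ = μ := by
    conv_rhs => rw [← withDensity_one (μ := μ)]
    rw [← withDensity_add_left hk.ennreal_ofReal]
    congr 1
    ext x
    rw [Pi.add_apply, ← ENNReal.ofReal_add (hk0 x) (sub_nonneg.2 (hcases x).1.1),
      add_sub_cancel, ENNReal.ofReal_one, Pi.one_apply]
  have hP := (hasPoissonLaplace_poissonLaw μ).map_suspension T
  have hQ : HasPoissonLaplace (poissonLaw μ) (κ + m₂) :=
    h₂.symm ▸ hasPoissonLaplace_poissonLaw μ
  rw [← h₁] at hP
  have := Measure.isProbabilityMeasure_map (μ := poissonLaw μ)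
    (suspension T).measurable.aemeasurable
  have hd₁ : Measurable fun x => ENNReal.ofReal (r x - k x) := (hr.sub hk).ennreal_ofReal
  have hd₂ : Measurable fun x => ENNReal.ofReal (1 - k x) := (hk.const_sub 1).ennreal_ofReal
  constructor
  · refine hP.absolutelyContinuous hQ
      (withDensity_absolutelyContinuous_withDensity hd₁ hd₂ ?_)
    filter_upwards [rnDer_pos hT.1] with x hx
    rw [ENNReal.ofReal_eq_zero, ENNReal.ofReal_eq_zero]
    exact ((hcases x).2.2 hx).2
  · refine hQ.absolutelyContinuous hP
      (withDensity_absolutelyContinuous_withDensity hd₂ hd₁ ?_)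
    filter_upwards [rnDer_pos hT.1] with x hx
    rw [ENNReal.ofReal_eq_zero, ENNReal.ofReal_eq_zero]
    exact ((hcases x).2.2 hx).1

/-! ### Iterates, translates and saturations -/

/-- The iterate `Tᵏ`, `k ∈ ℤ`. -/
def iter (T : X ≃ᵐ X) (k : ℤ) : X → X := ((T.toEquiv : Equiv.Perm X) ^ k : Equiv.Perm X)

theorem iter_zero (T : X ≃ᵐ X) (x : X) : iter T 0 x = x := by simp [iter]

theorem iter_iter (T : X ≃ᵐ X) (j k : ℤ) (x : X) : iter T j (iter T k x) = iter T (j + k) x := by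
  simp [iter, zpow_add]

theorem iter_apply_self (T : X ≃ᵐ X) (k : ℤ) (x : X) : iter T k (T x) = iter T (k + 1) x := by
  simp [iter, zpow_add]

theorem measurable_iter (T : X ≃ᵐ X) (k : ℤ) : Measurable (iter T k) := by
  induction k using Int.induction_on with
  | zero =>
    have h : iter T 0 = id := funext (iter_zero T)
    exact h ▸ measurable_id
  | succ n ih =>
    have h : iter T (n + 1) = iter T n ∘ T := funext fun x => (iter_apply_self T n x).symm
    exact h ▸ ih.comp T.measurable
  | pred n ih =>
    have h : iter T (-n - 1) = iter T (-n) ∘ T.symm := funext fun x => by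
      rw [Function.comp_apply, ← sub_add_cancel (-(n : ℤ)) 1, ← iter_apply_self,
        T.apply_symm_apply, sub_add_cancel]
    exact h ▸ ih.comp T.symm.measurable

/-- The translate `Tᵏ A`. -/
def translate (T : X ≃ᵐ X) (A : Set X) (k : ℤ) : Set X := iter T (-k) ⁻¹' A

/-- The union of all translates of `A`. -/
def saturation (T : X ≃ᵐ X) (A : Set X) : Set X := ⋃ k : ℤ, translate T A k

theorem measurableSet_translate (T : X ≃ᵐ X) {A : Set X} (hA : MeasurableSet A) (k : ℤ) :
    MeasurableSet (translate T A k) := measurable_iter T _ hA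

theorem measurableSet_saturation (T : X ≃ᵐ X) {A : Set X} (hA : MeasurableSet A) :
    MeasurableSet (saturation T A) := .iUnion fun k => measurableSet_translate T hA k

theorem mem_translate {T : X ≃ᵐ X} {A : Set X} {k : ℤ} {x : X} :
    x ∈ translate T A k ↔ iter T (-k) x ∈ A := Iff.rfl

theorem mem_saturation {T : X ≃ᵐ X} {A : Set X} {x : X} :
    x ∈ saturation T A ↔ ∃ k : ℤ, iter T k x ∈ A := by
  simp only [saturation, Set.mem_iUnion, mem_translate]
  exact (Equiv.neg ℤ).exists_congr_left.trans (by simp)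

theorem subset_saturation (T : X ≃ᵐ X) (A : Set X) : A ⊆ saturation T A := fun x hx =>
  mem_saturation.2 ⟨0, by rwa [iter_zero]⟩

theorem saturation_mono (T : X ≃ᵐ X) {A B : Set X} (h : A ⊆ B) :
    saturation T A ⊆ saturation T B := fun _ hx =>
  let ⟨k, hk⟩ := mem_saturation.1 hx
  mem_saturation.2 ⟨k, h hk⟩

theorem iter_mem_saturation {T : X ≃ᵐ X} {A : Set X} {x : X} {k : ℤ} :
    iter T k x ∈ saturation T A ↔ x ∈ saturation T A := by
  simp only [mem_saturation, iter_iter]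
  exact (Equiv.addRight k).exists_congr_left.trans (by simp)

theorem preimage_translate (T : X ≃ᵐ X) (A : Set X) (k : ℤ) :
    T ⁻¹' translate T A k = translate T A (k - 1) := by
  ext x
  rw [Set.mem_preimage, mem_translate, mem_translate, iter_apply_self, neg_sub, neg_add_eq_sub]

/-! ### The defect vanishes on the recurrent part -/

/-- The signed measure `μ ∘ T⁻¹ - μ`. -/
def defect (μ : Measure X) (T : X ≃ᵐ X) (E : Set X) : ℝ := ∫ x in E, (rnDer μ T x - 1) ∂μ

section Defect

variable {μ : Measure X} {T : X ≃ᵐ X}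

theorem measure_preimage_eq_lintegral [SigmaFinite μ] (hT : IsNonsingular μ T) {E : Set X}
    (hE : MeasurableSet E) :
    μ (T ⁻¹' E) = ∫⁻ x in E, ENNReal.ofReal (rnDer μ T x) ∂μ := by
  rw [← Measure.map_apply T.measurable hE, ← withDensity_rnDer hT, withDensity_apply _ hE]

theorem integrableOn_rnDer (hT : MemAut₁ μ T) {E : Set X} (hμE : μ E ≠ ∞) :
    IntegrableOn (rnDer μ T) E μ := by
  have h1 : IntegrableOn (fun _ => (1 : ℝ)) E μ := integrableOn_const hμE
  exact (hT.2.integrableOn.add h1).congr (ae_of_all _ fun x => sub_add_cancel _ _)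

theorem measure_preimage_ne_top [SigmaFinite μ] (hT : MemAut₁ μ T) {E : Set X} (hE : MeasurableSet E)
    (hμE : μ E ≠ ∞) : μ (T ⁻¹' E) ≠ ∞ := by
  rw [measure_preimage_eq_lintegral hT.1 hE]
  exact (integrableOn_rnDer hT hμE).lintegral_lt_top.ne

theorem measure_ne_top_of_preimage [SigmaFinite μ] (hT : MemAut₁ μ T) {E : Set X} (hE : MeasurableSet E)
    (hμE : μ (T ⁻¹' E) ≠ ∞) : μ E ≠ ∞ := by
  have hr : Measurable fun x => ENNReal.ofReal (rnDer μ T x) :=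
    (measurable_rnDer μ T).ennreal_ofReal
  -- Integrate `1 ≤ r + |r - 1|` over `E`.
  have h1 : μ E ≤ μ (T ⁻¹' E) + ∫⁻ x in E, ENNReal.ofReal |rnDer μ T x - 1| ∂μ := by
    rw [measure_preimage_eq_lintegral hT.1 hE, ← lintegral_add_left hr, ← setLIntegral_one]
    refine lintegral_mono fun x => ?_
    rw [← ENNReal.ofReal_add (rnDer_nonneg μ T x) (abs_nonneg _), ← ENNReal.ofReal_one]
    refine ENNReal.ofReal_le_ofReal ?_
    have := neg_abs_le (rnDer μ T x - 1)
    linarith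
  refine (h1.trans_lt (ENNReal.add_lt_top.2 ⟨hμE.lt_top, ?_⟩)).ne
  exact Integrable.lintegral_lt_top hT.2.abs.integrableOn

/-- The difference of measures makes sense only for sets of finite measure, whereas `defect` is
defined for every set. Saturations, whose measure may be infinite, are reached from finite-measure
sets by monotone limits. -/
theorem defect_eq [SigmaFinite μ] (hT : MemAut₁ μ T) {E : Set X} (hE : MeasurableSet E) (hμE : μ E ≠ ∞) :
    defect μ T E = μ.real (T ⁻¹' E) - μ.real E := by
  have h1 : IntegrableOn (fun _ => (1 : ℝ)) E μ := integrableOn_const hμE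
  rw [defect, integral_sub (integrableOn_rnDer hT hμE) h1, setIntegral_const, smul_eq_mul, mul_one,
    integral_eq_lintegral_of_nonneg_ae (ae_of_all _ fun x => rnDer_nonneg μ T x)
      (measurable_rnDer μ T).aestronglyMeasurable,
    ← measure_preimage_eq_lintegral hT.1 hE, measureReal_def, measureReal_def]

theorem measure_translate_ne_top [SigmaFinite μ] (hT : MemAut₁ μ T) {A : Set X} (hA : MeasurableSet A)
    (hμA : μ A ≠ ∞) (k : ℤ) : μ (translate T A k) ≠ ∞ := by
  induction k using Int.induction_on with
  | zero =>
    convert hμA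
    ext x
    rw [mem_translate, neg_zero, iter_zero]
  | succ n ih =>
    refine measure_ne_top_of_preimage hT (measurableSet_translate T hA _) ?_
    rwa [preimage_translate, add_sub_cancel_right]
  | pred n ih =>
    rw [← preimage_translate]
    exact measure_preimage_ne_top hT (measurableSet_translate T hA _) ih

theorem defect_translate [SigmaFinite μ] (hT : MemAut₁ μ T) {A : Set X} (hA : MeasurableSet A)
    (hμA : μ A ≠ ∞) (k : ℤ) :
    defect μ T (translate T A k) = μ.real (translate T A (k - 1)) - μ.real (translate T A k) := by
  rw [defect_eq hT (measurableSet_translate T hA k) (measure_translate_ne_top hT hA hμA k),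
    preimage_translate]

theorem tendsto_defect (hT : MemAut₁ μ T) {D : ℕ → Set X} (hD : ∀ n, MeasurableSet (D n))
    (hmono : Monotone D) :
    Tendsto (fun n => defect μ T (D n)) atTop (𝓝 (defect μ T (⋃ n, D n))) :=
  tendsto_setIntegral_of_monotone hD hmono hT.2.integrableOn

theorem tendsto_measureReal_zero {D : ℕ → Set X} (hD : ∀ n, MeasurableSet (D n))
    (hanti : Antitone D) (hfin : μ (D 0) ≠ ∞) (hempty : ⋂ n, D n = ∅) :
    Tendsto (fun n => μ.real (D n)) atTop (𝓝 0) := by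
  have h := tendsto_measure_iInter_atTop (μ := μ) (fun n => (hD n).nullMeasurableSet) hanti
    ⟨0, hfin⟩
  rw [hempty, measure_empty] at h
  exact (ENNReal.tendsto_toReal ENNReal.zero_ne_top).comp h

theorem exists_iter_mem_of_recurrent {A : Set X} {ε : ℤ}
    (h : ∀ x ∈ A, ∃ n : ℕ, 1 ≤ n ∧ iter T (ε * n) x ∈ A) (m : ℕ) :
    ∀ x ∈ A, ∃ n : ℕ, m ≤ n ∧ iter T (ε * n) x ∈ A := by
  induction m with
  | zero => exact fun x hx => ⟨0, le_rfl, by simpa [iter_zero] using hx⟩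
  | succ m ih =>
    intro x hx
    obtain ⟨n, hn, hxn⟩ := ih x hx
    obtain ⟨n', hn', hxn'⟩ := h _ hxn
    refine ⟨n' + n, by omega, ?_⟩
    rwa [iter_iter, ← mul_add, ← Nat.cast_add] at hxn'

/-- The set of the points that visit `A` at one of the times `0, ε, 2ε, …, Mε`. -/
def visits (T : X ≃ᵐ X) (A : Set X) (ε : ℤ) (M : ℕ) : Set X :=
  ⋃ n ∈ Finset.range (M + 1), iter T (ε * n) ⁻¹' A

theorem mem_visits {A : Set X} {ε : ℤ} {M : ℕ} {x : X} :
    x ∈ visits T A ε M ↔ ∃ n : ℕ, n ≤ M ∧ iter T (ε * n) x ∈ A := by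
  simp [visits]

theorem measurableSet_visits {A : Set X} (hA : MeasurableSet A) (ε : ℤ) (M : ℕ) :
    MeasurableSet (visits T A ε M) :=
  Finset.measurableSet_biUnion _ fun _ _ => measurable_iter T _ hA

theorem monotone_visits (A : Set X) (ε : ℤ) : Monotone (visits T A ε) := fun M N h x hx => by
  obtain ⟨n, hn, hx⟩ := mem_visits.1 hx
  exact mem_visits.2 ⟨n, hn.trans h, hx⟩

theorem measure_visits_ne_top [SigmaFinite μ] (hT : MemAut₁ μ T) {A : Set X} (hA : MeasurableSet A)
    (hμA : μ A ≠ ∞) (ε : ℤ) (M : ℕ) : μ (visits T A ε M) ≠ ∞ := by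
  refine ((measure_biUnion_finset_le _ _).trans_lt (ENNReal.sum_lt_top.2 fun n _ => ?_)).ne
  have := measure_translate_ne_top hT hA hμA (-(ε * n))
  rw [translate, neg_neg] at this
  exact this.lt_top

theorem iUnion_visits {A : Set X} {ε : ℤ} (hε : ε = 1 ∨ ε = -1)
    (h : ∀ x ∈ A, ∃ n : ℕ, 1 ≤ n ∧ iter T (ε * n) x ∈ A) :
    ⋃ M, visits T A ε M = saturation T A := by
  ext x
  simp only [Set.mem_iUnion, mem_visits, mem_saturation]
  constructor
  · rintro ⟨M, n, -, hx⟩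
    exact ⟨_, hx⟩
  · rintro ⟨k, hk⟩
    -- A return after at least `|k|` steps makes `n + ε k` nonnegative; since `ε² = 1`, it is a
    -- visiting time of `x` in the direction `ε`.
    obtain ⟨n, hn, hxn⟩ := exists_iter_mem_of_recurrent h k.natAbs _ hk
    rw [iter_iter] at hxn
    refine ⟨_, (n + ε * k).toNat, le_rfl, ?_⟩
    convert hxn using 2
    rcases hε with rfl | rfl <;> omega

/-- For `D = A ∪ T A ∪ … ∪ T^M A`, the preimage `T⁻¹ D` gains over `D` at most the part of `T⁻¹ A`
outside `D`. Recurrence in the past makes these unions exhaust the saturation, which contains `T⁻¹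
A`, so the gain tends to `0`. -/
theorem defect_saturation_nonpos [SigmaFinite μ] (hT : MemAut₁ μ T) {A : Set X} (hA : MeasurableSet A)
    (hμA : μ A ≠ ∞) (h : ∀ x ∈ A, ∃ n : ℕ, 1 ≤ n ∧ iter T (-1 * n) x ∈ A) :
    defect μ T (saturation T A) ≤ 0 := by
  have hD := fun M => measurableSet_visits (T := T) hA (-1) M
  have hfin := fun M => measure_visits_ne_top hT hA hμA (-1) M
  have hmono := monotone_visits (T := T) A (-1)
  have hTA := T.measurable hA
  have hun := iUnion_visits (Or.inr rfl) h
  have hfinA := measure_preimage_ne_top hT hA hμA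
  have h1 := (tendsto_defect hT hD hmono).comp (tendsto_add_atTop_nat 1)
  rw [hun] at h1
  have h2 := tendsto_measureReal_zero (μ := μ) (D := fun M => T ⁻¹' A \ visits T A (-1) M)
    (fun M => hTA.diff (hD M)) (fun M N hMN => Set.sdiff_subset_sdiff_right (hmono hMN))
    (ne_top_of_le_ne_top hfinA (measure_mono Set.sdiff_subset)) (by
      rw [← Set.sdiff_iUnion, hun, Set.sdiff_eq_empty]
      exact fun x hx => mem_saturation.2 ⟨1, by
        have := iter_apply_self T 0 x
        rw [zero_add, iter_zero] at this
        rwa [← this]⟩)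
  refine le_of_tendsto_of_tendsto' h1 h2 fun M => ?_
  rw [Function.comp_apply, defect_eq hT (hD _) (hfin _), sub_le_iff_le_add]
  have hsub : T ⁻¹' visits T A (-1) (M + 1) ⊆
      (T ⁻¹' A \ visits T A (-1) M) ∪ visits T A (-1) (M + 1) := by
    intro x hx
    obtain ⟨n, hn, hxn⟩ := mem_visits.1 hx
    rcases n with _ | n
    · by_cases hxM : x ∈ visits T A (-1) M
      · exact Or.inr (hmono (Nat.le_succ M) hxM)
      · exact Or.inl ⟨by simpa [iter_zero] using hxn, hxM⟩
    · refine Or.inr (mem_visits.2 ⟨n, by omega, ?_⟩)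
      rw [iter_apply_self] at hxn
      convert hxn using 2
      push_cast
      ring
  refine (measureReal_mono hsub (measure_union_lt_top ?_ (hfin _).lt_top).ne).trans
    (measureReal_union_le _ _)
  exact (measure_mono Set.sdiff_subset).trans_lt hfinA.lt_top

/-- The mirror image: for unions of `T⁻ⁿ A`, the only part of `D` that `T⁻¹ D` can miss lies in `A`,
and it shrinks to the empty set under recurrence in the future. -/
theorem defect_saturation_nonneg [SigmaFinite μ] (hT : MemAut₁ μ T) {A : Set X} (hA : MeasurableSet A)
    (hμA : μ A ≠ ∞) (h : ∀ x ∈ A, ∃ n : ℕ, 1 ≤ n ∧ iter T (1 * n) x ∈ A) :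
    0 ≤ defect μ T (saturation T A) := by
  have hD := fun M => measurableSet_visits (T := T) hA 1 M
  have hfin := fun M => measure_visits_ne_top hT hA hμA 1 M
  have hmono := monotone_visits (T := T) A 1
  have hun := iUnion_visits (Or.inl rfl) h
  have h1 := tendsto_defect hT hD hmono
  rw [hun] at h1
  have h2 := tendsto_measureReal_zero (μ := μ) (D := fun M => A \ T ⁻¹' visits T A 1 M)
    (fun M => hA.diff (T.measurable (hD M)))
    (fun M N hMN => Set.sdiff_subset_sdiff_right (Set.preimage_mono (hmono hMN)))
    (ne_top_of_le_ne_top hμA (measure_mono Set.sdiff_subset)) (by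
      rw [← Set.sdiff_iUnion, ← Set.preimage_iUnion, hun, Set.sdiff_eq_empty]
      refine fun x hx => mem_saturation.2 ⟨-1, ?_⟩
      rwa [iter_apply_self, neg_add_cancel, iter_zero])
  have h3 := h2.neg
  rw [neg_zero] at h3
  refine le_of_tendsto_of_tendsto' h3 h1 fun M => ?_
  rw [defect_eq hT (hD _) (hfin _), neg_le_sub_iff_le_add]
  have hsub : visits T A 1 M ⊆ T ⁻¹' visits T A 1 M ∪ (A \ T ⁻¹' visits T A 1 M) := by
    intro x hx
    by_cases hxM : T x ∈ visits T A 1 M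
    · exact Or.inl hxM
    · refine Or.inr ⟨?_, hxM⟩
      obtain ⟨n, hn, hxn⟩ := mem_visits.1 hx
      rcases n with _ | n
      · simpa [iter_zero] using hxn
      · refine (hxM (mem_visits.2 ⟨n, by omega, ?_⟩)).elim
        rw [iter_apply_self]
        convert hxn using 2
        push_cast
        ring
  refine (measureReal_mono hsub (measure_union_lt_top
    (measure_preimage_ne_top hT (hD M) (hfin M)).lt_top ?_).ne).trans (measureReal_union_le _ _)
  exact (measure_mono Set.sdiff_subset).trans_lt hμA.lt_top

theorem defect_saturation_diff (hT : MemAut₁ μ T) {A W : Set X} (hA : MeasurableSet A)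
    (hW : MeasurableSet W) (hWA : W ⊆ A) :
    defect μ T (saturation T A) =
      defect μ T (saturation T W) + defect μ T (saturation T (A \ saturation T W)) := by
  have hsat := measurableSet_saturation T hW
  have hunion : saturation T A = saturation T W ∪ saturation T (A \ saturation T W) := by
    ext x
    constructor
    · intro hx
      by_cases hxW : x ∈ saturation T W
      · exact Or.inl hxW
      · obtain ⟨k, hk⟩ := mem_saturation.1 hx
        exact Or.inr (mem_saturation.2 ⟨k, hk, fun h => hxW (iter_mem_saturation.1 h)⟩)
    · rintro (hx | hx)
      · exact saturation_mono T hWA hx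
      · exact saturation_mono T Set.sdiff_subset hx
  rw [defect, hunion, setIntegral_union ?_ (measurableSet_saturation T (hA.diff hsat))
    hT.2.integrableOn hT.2.integrableOn]
  · rfl
  · refine Set.disjoint_left.2 fun x hx hx' => ?_
    obtain ⟨k, hk⟩ := mem_saturation.1 hx'
    exact hk.2 (iter_mem_saturation.2 hx)

/-! ### Extracting a wandering set -/

/-- The points of `A` that do not visit `A` at the times `ε, 2ε, 3ε, …`. -/
def nonReturning (T : X ≃ᵐ X) (A : Set X) (ε : ℤ) : Set X :=
  A ∩ ⋂ n : ℕ, (iter T (ε * (n + 1 : ℕ)) ⁻¹' A)ᶜ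

theorem measurableSet_nonReturning {A : Set X} (hA : MeasurableSet A) (ε : ℤ) :
    MeasurableSet (nonReturning T A ε) :=
  hA.inter (.iInter fun _ => (measurable_iter T _ hA).compl)

/-- If `T⁻ʲ x` and `T⁻ᵏ x` both lie in the set with `j ≠ k`, one of them is a later point, in the
direction `ε`, of the orbit of the other, hence a forbidden return to `A`. -/
theorem pairwise_disjoint_nonReturning (A : Set X) {ε : ℤ} (hε : ε = 1 ∨ ε = -1) :
    Pairwise fun j k : ℤ =>
      Disjoint (translate T (nonReturning T A ε) j) (translate T (nonReturning T A ε) k) := by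
  have key : ∀ j k : ℤ, 0 < ε * (j - k) →
      Disjoint (translate T (nonReturning T A ε) j) (translate T (nonReturning T A ε) k) := by
    intro j k hjk
    refine Set.disjoint_left.2 fun x hx hx' => ?_
    have h1 := Set.mem_iInter.1 hx.2 (ε * (j - k) - 1).toNat
    refine h1 ?_
    rw [Set.mem_preimage, iter_iter]
    convert hx'.1 using 2
    rcases hε with rfl | rfl <;> omega
  intro j k hjk
  rcases lt_or_gt_of_ne hjk with h | h <;> rcases hε with rfl | rfl
  · exact (key k j (by omega)).symm
  · exact key j k (by omega)
  · exact key j k (by omega)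
  · exact (key k j (by omega)).symm

theorem recurrent_diff_saturation {A : Set X} {ε : ℤ}
    (h : ∀ x ∈ A, ∃ n : ℕ, 1 ≤ n ∧ iter T (ε * n) x ∈ A) (W : Set X) :
    ∀ x ∈ A \ saturation T W, ∃ n : ℕ, 1 ≤ n ∧ iter T (ε * n) x ∈ A \ saturation T W := by
  intro x hx
  obtain ⟨n, hn, hxn⟩ := h x hx.1
  exact ⟨n, hn, hxn, fun h => hx.2 (iter_mem_saturation.1 h)⟩

theorem recurrent_diff_nonReturning (A : Set X) (ε : ℤ) :
    ∀ x ∈ A \ saturation T (nonReturning T A ε), ∃ n : ℕ, 1 ≤ n ∧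
      iter T (ε * n) x ∈ A \ saturation T (nonReturning T A ε) := by
  intro x hx
  by_contra! hcon
  refine hx.2 (subset_saturation T _ ⟨hx.1, Set.mem_iInter.2 fun n hn => ?_⟩)
  exact hcon (n + 1) (by omega) ⟨hn, fun h => hx.2 (iter_mem_saturation.1 h)⟩

/-- If `χ(T) ≠ 0` then `μ ∘ T⁻¹ - μ` charges the saturation of a wandering set. -/
theorem exists_wandering [SigmaFinite μ] (hT : MemAut₁ μ T) (hχ : chi μ T ≠ 0) :
    ∃ W : Set X, MeasurableSet W ∧ μ W ≠ ∞ ∧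
      (Pairwise fun j k : ℤ => Disjoint (translate T W j) (translate T W k)) ∧
      defect μ T (saturation T W) ≠ 0 := by
  obtain ⟨A, hA, hμA, hdA⟩ : ∃ A : Set X, MeasurableSet A ∧ μ A ≠ ∞ ∧
      defect μ T (saturation T A) ≠ 0 := by
    have h := tendsto_defect hT (D := fun n => saturation T (spanningSets μ n))
      (fun n => measurableSet_saturation T (measurableSet_spanningSets μ n))
      (fun m n hmn => saturation_mono T (monotone_spanningSets μ hmn))
    have huniv : ⋃ n, saturation T (spanningSets μ n) = Set.univ := by
      rw [← Set.univ_subset_iff, ← iUnion_spanningSets μ]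
      exact Set.iUnion_mono fun n => subset_saturation T _
    rw [huniv, defect, setIntegral_univ] at h
    by_contra! hcon
    refine hχ (tendsto_nhds_unique h ?_)
    have h0 : ∀ n, defect μ T (saturation T (spanningSets μ n)) = 0 := fun n =>
      hcon _ (measurableSet_spanningSets μ n) (measure_spanningSets_lt_top μ n).ne
    simp_rw [h0]
    exact tendsto_const_nhds
  -- Remove the orbits through points with no past return, then, from what is left, those through
  -- points with no future return. The remainder `A₂` is recurrent in both directions: removing
  -- whole orbits does not destroy the past returns.
  set W₁ := nonReturning T A (-1)
  set A₁ := A \ saturation T W₁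
  set W₂ := nonReturning T A₁ 1
  set A₂ := A₁ \ saturation T W₂
  have mW₁ : MeasurableSet W₁ := measurableSet_nonReturning hA _
  have mA₁ : MeasurableSet A₁ := hA.diff (measurableSet_saturation T mW₁)
  have mW₂ : MeasurableSet W₂ := measurableSet_nonReturning mA₁ _
  have mA₂ : MeasurableSet A₂ := mA₁.diff (measurableSet_saturation T mW₂)
  have fA₁ : μ A₁ ≠ ∞ := ne_top_of_le_ne_top hμA (measure_mono Set.sdiff_subset)
  have fA₂ : μ A₂ ≠ ∞ := ne_top_of_le_ne_top fA₁ (measure_mono Set.sdiff_subset)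
  have e₁ := defect_saturation_diff hT hA mW₁ Set.inter_subset_left
  have e₂ := defect_saturation_diff hT mA₁ mW₂ Set.inter_subset_left
  have e₃ : defect μ T (saturation T A₂) = 0 :=
    le_antisymm
      (defect_saturation_nonpos hT mA₂ fA₂
        (recurrent_diff_saturation (recurrent_diff_nonReturning A (-1)) W₂))
      (defect_saturation_nonneg hT mA₂ fA₂ (recurrent_diff_nonReturning A₁ 1))
  by_cases h₁ : defect μ T (saturation T W₁) = 0
  · refine ⟨W₂, mW₂, ne_top_of_le_ne_top fA₁ (measure_mono Set.inter_subset_left),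
      pairwise_disjoint_nonReturning A₁ (Or.inl rfl), fun h₂ => hdA ?_⟩
    rw [e₁, h₁, e₂, h₂, e₃, add_zero, add_zero]
  · exact ⟨W₁, mW₁, ne_top_of_le_ne_top hμA (measure_mono Set.inter_subset_left),
      pairwise_disjoint_nonReturning A (Or.inr rfl), h₁⟩

end Defect

/-! ### Exponential moments and almost sure drift of the counts -/

theorem lintegral_exp_count (μ : Measure X) [SFinite μ] {U : Set X} (hU : MeasurableSet U)
    (hfin : μ U ≠ ∞) (s : ℝ) :
    ∫⁻ ω, ENNReal.ofReal (Real.exp (s * (ω.1 U).toReal)) ∂(poissonLaw μ) =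
      ENNReal.ofReal (Real.exp (μ.real U * (Real.exp s - 1))) := by
  have hf : Measurable fun y : ℝ => ENNReal.ofReal (Real.exp (s * y)) := by fun_prop
  rw [← lintegral_map hf (measurable_count hU).ennreal_toReal, map_toReal_count μ hU hfin,
    lintegral_map hf Measurable.of_discrete, poissonMeasure, lintegral_sum_measure]
  have h := ((NormedSpace.expSeries_div_hasSum_exp (μ.real U * Real.exp s)).mul_left
    (Real.exp (-μ.real U)))
  rw [← Real.exp_eq_exp_ℝ, ← Real.exp_add, neg_add_eq_sub, ← mul_sub_one] at h
  rw [← h.tsum_eq, ENNReal.ofReal_tsum_of_nonneg (fun n => by positivity) h.summable]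
  refine tsum_congr fun n => ?_
  rw [lintegral_smul_measure, lintegral_dirac, smul_eq_mul, ← ENNReal.ofReal_mul (by positivity),
    mul_comm s, Real.exp_nat_mul, mul_pow]
  congr 1
  change Real.exp (-μ.real U) * μ.real U ^ n / _ * _ = _
  ring

/-- As a function of `t` the expression vanishes at `0` with derivative `-(c - l)²`. The explicit
`t` gives `|t (c - l)| ≤ 1`, hence `e^s - 1 ≤ s + s²` for `s = t (c - l)`, and `l t < 1`; the bound
becomes `-t (c - l)² (1 - l t)`. -/
theorem exists_exponent {l c : ℝ} (hl : 0 ≤ l) (hc : c ≠ l) :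
    ∃ t : ℝ, 0 < t ∧ l * (Real.exp (t * (c - l)) - 1) - t * (c - l) * c < 0 := by
  have hpos : 0 < 1 + l + |c - l| := by positivity
  set t := (1 + l + |c - l|)⁻¹ with ht
  have ht0 : 0 < t := inv_pos.2 hpos
  have ht1 : t * (1 + l + |c - l|) = 1 := inv_mul_cancel₀ hpos.ne'
  refine ⟨t, ht0, ?_⟩
  have habs : |t * (c - l)| ≤ 1 := by
    rw [abs_mul, abs_of_pos ht0]
    nlinarith [mul_nonneg ht0.le hl, mul_nonneg ht0.le (abs_nonneg (c - l))]
  have h1 := (abs_le.1 (Real.abs_exp_sub_one_sub_id_le habs)).2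
  have h2 : l * (Real.exp (t * (c - l)) - 1) ≤ l * (t * (c - l) + (t * (c - l)) ^ 2) :=
    mul_le_mul_of_nonneg_left (by linarith) hl
  have h3 : 0 < t * (c - l) ^ 2 := mul_pos ht0 (by positivity [sub_ne_zero.2 hc])
  have h4 : l * t < 1 := by
    nlinarith [mul_nonneg ht0.le (abs_nonneg (c - l))]
  nlinarith [mul_pos h3 (sub_pos.2 h4)]

/-- A Chernoff bound: the expectations of `exp (s (ω (U n) - n c))` are eventually dominated by
`e^{nδ}` with `δ < 0`. They are summable, so the exponentials tend to `0` almost surely and their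
exponents to `-∞`. Only the law of each single count enters, not independence. -/
theorem tendsto_count_sub (μ : Measure X) [SFinite μ] {U : ℕ → Set X}
    (hU : ∀ n, MeasurableSet (U n)) (hfin : ∀ n, μ (U n) ≠ ∞) {l c : ℝ}
    (hl : Tendsto (fun n : ℕ => (n : ℝ)⁻¹ * μ.real (U n)) atTop (𝓝 l)) (hc : c ≠ l) :
    ∀ᵐ ω ∂(poissonLaw μ),
      Tendsto (fun n : ℕ => (c - l) * ((ω.1 (U n)).toReal - n * c)) atTop atBot := by
  have hl0 : 0 ≤ l := ge_of_tendsto' hl fun n => by positivity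
  obtain ⟨t, ht, hneg⟩ := exists_exponent hl0 hc
  set s := t * (c - l) with hs
  obtain ⟨δ, hδ, hδ0⟩ := exists_between hneg
  have hev : ∀ᶠ n : ℕ in atTop, μ.real (U n) * (Real.exp s - 1) - s * (n * c) ≤ n * δ := by
    have h := (hl.mul_const (Real.exp s - 1)).sub_const (s * c)
    filter_upwards [h.eventually_lt_const hδ, eventually_gt_atTop 0] with n hn hn0
    have hn0' : (0 : ℝ) < n := Nat.cast_pos.2 hn0
    have h2 := mul_le_mul_of_nonneg_left hn.le hn0'.le
    have h3 : (n : ℝ) * ((n : ℝ)⁻¹ * μ.real (U n) * (Real.exp s - 1) - s * c) =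
        μ.real (U n) * (Real.exp s - 1) - s * (n * c) := by
      field_simp
    rwa [h3] at h2
  have hsum : Summable fun n : ℕ =>
      Real.exp (μ.real (U n) * (Real.exp s - 1) - s * (n * c)) := by
    refine Summable.of_norm_bounded_eventually_nat (g := fun n : ℕ => Real.exp (n * δ))
      (Real.summable_exp_nat_mul_iff.2 hδ0) ?_
    filter_upwards [hev] with n hn
    rw [Real.norm_of_nonneg (Real.exp_pos _).le]
    exact Real.exp_le_exp.2 hn
  have hmeas : ∀ n, Measurable fun ω : Config X =>
      ENNReal.ofReal (Real.exp (s * ((ω.1 (U n)).toReal - n * c))) := fun n =>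
    (Real.measurable_exp.comp
      (((measurable_count (hU n)).ennreal_toReal.sub_const _).const_mul s)).ennreal_ofReal
  have hint : ∀ n : ℕ, ∫⁻ ω, ENNReal.ofReal (Real.exp (s * ((ω.1 (U n)).toReal - n * c)))
      ∂(poissonLaw μ) =
        ENNReal.ofReal (Real.exp (μ.real (U n) * (Real.exp s - 1) - s * (n * c))) := by
    intro n
    simp_rw [mul_sub s, Real.exp_sub, div_eq_mul_inv]
    simp_rw [ENNReal.ofReal_mul (Real.exp_pos _).le]
    have hm : Measurable fun ω : Config X => ENNReal.ofReal (Real.exp (s * (ω.1 (U n)).toReal)) :=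
      (Real.measurable_exp.comp ((measurable_count (hU n)).ennreal_toReal.const_mul s)).ennreal_ofReal
    rw [lintegral_mul_const _ hm, lintegral_exp_count μ (hU n) (hfin n)]
  have htsum : ∫⁻ ω, ∑' n : ℕ, ENNReal.ofReal (Real.exp (s * ((ω.1 (U n)).toReal - n * c)))
      ∂(poissonLaw μ) ≠ ∞ := by
    rw [lintegral_tsum fun n => (hmeas n).aemeasurable]
    simp_rw [hint]
    rw [← ENNReal.ofReal_tsum_of_nonneg (fun n => (Real.exp_pos _).le) hsum]
    exact ENNReal.ofReal_ne_top
  filter_upwards [ae_lt_top (Measurable.tsum hmeas) htsum] with ω hω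
  have h1 := ENNReal.tendsto_atTop_zero_of_tsum_ne_top hω.ne
  have h2 := (ENNReal.tendsto_toReal ENNReal.zero_ne_top).comp h1
  have h3 : Tendsto (fun n : ℕ => Real.exp (s * ((ω.1 (U n)).toReal - n * c))) atTop (𝓝 0) :=
    h2.congr fun n => ENNReal.toReal_ofReal (Real.exp_pos _).le
  have h4 := Real.tendsto_exp_comp_nhds_zero.1 h3
  refine (h4.const_mul_atBot (inv_pos.2 ht)).congr fun n => ?_
  rw [hs, mul_assoc, inv_mul_cancel_left₀ ht.ne']

/-! ### First maximum of a two-sided walk -/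

/-- The time `n` is the first one at which the walk with increments `a` takes its maximum. -/
def IsFirstMax (a : ℤ → ℝ) (n : ℤ) : Prop :=
  (∀ m : ℕ, ∑ i ∈ Finset.range m, a (n + i) ≤ 0) ∧
    ∀ m : ℕ, 0 < ∑ i ∈ Finset.range (m + 1), a (n - 1 - i)

/-- The increments over `[j, k)` would have a sum that is nonpositive, seen from `j`, and positive,
seen from `k`. -/
theorem IsFirstMax.not_lt_of {a : ℤ → ℝ} {j k : ℤ} (hj : IsFirstMax a j) (hk : IsFirstMax a k) :
    ¬ j < k := by
  intro hjk
  obtain ⟨m, hm⟩ : ∃ m : ℕ, k = j + (m + 1 : ℕ) := ⟨(k - j - 1).toNat, by omega⟩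
  refine (hk.2 m).not_ge (le_of_eq_of_le ?_ (hj.1 (m + 1)))
  rw [← Finset.sum_range_reflect]
  refine Finset.sum_congr rfl fun i hi => ?_
  have := Finset.mem_range.1 hi
  congr 1
  omega

theorem IsFirstMax.unique {a : ℤ → ℝ} {j k : ℤ} (hj : IsFirstMax a j) (hk : IsFirstMax a k) :
    j = k :=
  le_antisymm (not_lt.1 (hk.not_lt_of hj)) (not_lt.1 (hj.not_lt_of hk))

/-- The two-sided walk with increments `a` that starts at `0`. -/
def walk (a : ℤ → ℝ) : ℤ → ℝ
  | Int.ofNat n => ∑ i ∈ Finset.range n, a i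
  | Int.negSucc n => -∑ i ∈ Finset.range (n + 1), a (-1 - i)

theorem walk_succ (a : ℤ → ℝ) : ∀ j, walk a (j + 1) = walk a j + a j
  | Int.ofNat n => Finset.sum_range_succ (fun i : ℕ => a i) n
  | Int.negSucc 0 => by
    change walk a (Int.ofNat 0) = _
    simp [walk]
  | Int.negSucc (n + 1) => by
    change walk a (Int.negSucc n) = _
    have : Int.negSucc (n + 1) = -1 - ((n + 1 : ℕ) : ℤ) := by omega
    simp only [walk]
    rw [Finset.sum_range_succ _ (n + 1), this]
    ring

/-- A walk tending to `-∞` at both ends attains its maximum, and does so at finitely many times; the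
least of them qualifies. -/
theorem exists_isFirstMax {a : ℤ → ℝ}
    (h₁ : Tendsto (fun n : ℕ => ∑ i ∈ Finset.range n, a i) atTop atBot)
    (h₂ : Tendsto (fun n : ℕ => -∑ i ∈ Finset.range n, a (-1 - i)) atTop atBot) :
    ∃ n, IsFirstMax a n := by
  have htop : Tendsto (walk a) atTop atBot := by
    rw [← Nat.map_cast_int_atTop, tendsto_map'_iff]
    exact h₁
  have hbot : Tendsto (walk a) atBot atBot := by
    rw [← Filter.map_neg_atTop, ← Nat.map_cast_int_atTop, tendsto_map'_iff, tendsto_map'_iff]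
    refine h₂.congr fun n => ?_
    rcases n with _ | n
    · simp [walk, Function.comp]
    · rfl
  have hcof : Tendsto (walk a) cofinite atBot := by
    rw [Int.cofinite_eq]
    exact hbot.sup htop
  obtain ⟨j₀, hj₀⟩ := hcof.exists_forall_ge
  have hfin : {j | walk a j = walk a j₀}.Finite := by
    have := hcof.eventually (eventually_lt_atBot (walk a j₀))
    refine (Filter.eventually_cofinite.1 this).subset fun j hj => ?_
    exact not_lt.2 (le_of_eq (Eq.symm hj))
  obtain ⟨n, hn, hmin⟩ := Set.exists_min_image _ id hfin ⟨j₀, rfl⟩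
  have hmax : ∀ j, walk a j ≤ walk a n := fun j => (hj₀ j).trans_eq (Eq.symm hn)
  have hlt : ∀ j < n, walk a j < walk a n := fun j hj =>
    (hmax j).lt_of_ne fun h => (hmin j (h.trans hn)).not_gt hj
  refine ⟨n, fun m => ?_, fun m => ?_⟩
  · have : ∀ m : ℕ, ∑ i ∈ Finset.range m, a (n + i) = walk a (n + m) - walk a n := by
      intro m
      induction m with
      | zero => simp
      | succ m ih =>
        rw [Finset.sum_range_succ, ih, Nat.cast_succ, ← add_assoc, walk_succ]
        ring
    rw [this, sub_nonpos]
    exact hmax _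
  · have : ∀ m : ℕ, ∑ i ∈ Finset.range m, a (n - 1 - i) = walk a n - walk a (n - m) := by
      intro m
      induction m with
      | zero => simp
      | succ m ih =>
        have h := walk_succ a (n - 1 - m)
        rw [show n - 1 - (m : ℤ) + 1 = n - m by ring] at h
        rw [Finset.sum_range_succ, ih, Nat.cast_succ, h,
          show n - ((m : ℤ) + 1) = n - 1 - m by ring]
        ring
    rw [this, sub_pos]
    exact hlt _ (by omega)

/-! ### Dissipativity of the suspension -/

theorem perm_zpow_image {Y : Type*} (σ : Equiv.Perm Y) {B : ℤ → Set Y}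
    (h : ∀ n y, σ y ∈ B (n + 1) ↔ y ∈ B n) (n : ℤ) : (σ ^ n) '' B 0 = B n := by
  have key : ∀ k m y, (σ ^ k) y ∈ B (m + k) ↔ y ∈ B m := by
    intro k
    induction k using Int.induction_on with
    | zero => simp
    | succ i ih =>
      intro m y
      rw [add_comm (i : ℤ) 1, zpow_add, zpow_one, Equiv.Perm.mul_apply, add_comm 1 (i : ℤ),
        ← add_assoc, h, ih]
    | pred i ih =>
      intro m y
      rw [← h, ← Equiv.Perm.mul_apply, ← zpow_one_add, ← ih m y]
      rw [show m + (-(i : ℤ) - 1) + 1 = m + -i by ring, show 1 + (-(i : ℤ) - 1) = -i by ring]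
  ext y
  rw [Equiv.image_eq_preimage_symm, Set.mem_preimage]
  have := key n 0 ((σ ^ n).symm y)
  rwa [Equiv.apply_symm_apply, zero_add, iff_comm] at this

/-- Summability over `ℤ` gives summability over each half, where the partial sums telescope from the
common base value `u (-1)`. -/
theorem exists_tendsto_of_hasSum {u : ℤ → ℝ} {S : ℝ} (h : HasSum (fun k => u (k - 1) - u k) S) :
    ∃ l₁ l₂, Tendsto (fun n : ℕ => u n) atTop (𝓝 l₁) ∧
      Tendsto (fun n : ℕ => u (-1 - n)) atTop (𝓝 l₂) ∧ S = l₂ - l₁ := by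
  have s₁ : Summable fun n : ℕ => u ((n : ℤ) - 1) - u n :=
    h.summable.comp_injective Nat.cast_injective
  have s₂ : Summable fun n : ℕ => u (-((n : ℤ) + 1) - 1) - u (-((n : ℤ) + 1)) :=
    h.summable.comp_injective (i := fun n : ℕ => -((n : ℤ) + 1)) fun m n hmn => by
      simpa using hmn
  obtain ⟨a, ha⟩ := s₁
  obtain ⟨b, hb⟩ := s₂
  have hS := h.unique (HasSum.of_nat_of_neg_add_one ha hb)
  have e₁ : ∀ n : ℕ, ∑ i ∈ Finset.range n, (u ((i : ℤ) - 1) - u i) = u (-1) - u ((n : ℤ) - 1) := by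
    intro n
    induction n with
    | zero => simp
    | succ n ih => rw [Finset.sum_range_succ, ih, Nat.cast_succ, add_sub_cancel_right]; ring
  have e₂ : ∀ n : ℕ, ∑ i ∈ Finset.range n, (u (-((i : ℤ) + 1) - 1) - u (-((i : ℤ) + 1))) =
      u (-1 - n) - u (-1) := by
    intro n
    induction n with
    | zero => simp
    | succ n ih =>
      rw [Finset.sum_range_succ, ih, show -((n : ℤ) + 1) = -1 - n by ring, Nat.cast_succ,
        show -1 - (n : ℤ) - 1 = -1 - (n + 1) by ring]
      ring
  have t₁ := ha.tendsto_sum_nat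
  have t₂ := hb.tendsto_sum_nat
  simp_rw [e₁] at t₁
  simp_rw [e₂] at t₂
  refine ⟨u (-1) - a, b + u (-1), ?_, ?_, by rw [hS]; ring⟩
  · have := (t₁.const_sub (u (-1))).comp (tendsto_add_atTop_nat 1)
    refine this.congr fun n => ?_
    simp
  · refine (t₂.add_const (u (-1))).congr fun n => ?_
    simp

/-- The sum of the first `n` counts is the count of the union of the first `n` sets, whose measure
divided by `n` tends to `l` by Cesàro averaging. -/
theorem tendsto_sum_count (μ : Measure X) [SFinite μ] {V : ℕ → Set X}
    (hV : ∀ n, MeasurableSet (V n)) (hfin : ∀ n, μ (V n) ≠ ∞)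
    (hd : Pairwise fun m n => Disjoint (V m) (V n)) {l c : ℝ}
    (hl : Tendsto (fun n => μ.real (V n)) atTop (𝓝 l)) (hc : c ≠ l) :
    ∀ᵐ ω ∂(poissonLaw μ),
      Tendsto (fun n : ℕ => ∑ i ∈ Finset.range n, (c - l) * ((ω.1 (V i)).toReal - c))
        atTop atBot := by
  have hU : ∀ n, MeasurableSet (⋃ i ∈ Finset.range n, V i) := fun n =>
    Finset.measurableSet_biUnion _ fun i _ => hV i
  have hsum : ∀ (ν : Measure X) n, ν (⋃ i ∈ Finset.range n, V i) = ∑ i ∈ Finset.range n, ν (V i) :=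
    fun ν n => measure_biUnion_finset (fun i _ j _ hij => hd hij) fun i _ => hV i
  have h := tendsto_count_sub μ hU (fun n => by
    rw [hsum]
    exact ENNReal.sum_ne_top.2 fun i _ => hfin i) (l := l) (c := c) (by
      refine hl.cesaro.congr fun n => ?_
      rw [measureReal_def μ, hsum, ENNReal.toReal_sum fun i _ => hfin i]
      rfl) hc
  filter_upwards [h, ae_all_iff.2 fun n => ae_count_ne_top μ (hV n) (hfin n)] with ω hω hω'
  refine hω.congr fun n => ?_
  rw [hsum, ENNReal.toReal_sum fun i _ => hω' i, ← Finset.mul_sum, Finset.sum_sub_distrib]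
  simp

/-- The increment at time `k` of the walk that counts the points of `ω` in the translates of `W`. -/
def increment (T : X ≃ᵐ X) (W : Set X) (d c : ℝ) (ω : Config X) (k : ℤ) : ℝ :=
  d * ((ω.1 (translate T W k)).toReal - c)

theorem increment_suspension (T : X ≃ᵐ X) {W : Set X} (hW : MeasurableSet W) (d c : ℝ)
    (ω : Config X) (k : ℤ) :
    increment T W d c (suspension T ω) k = increment T W d c ω (k - 1) := by
  have : (suspension T ω).1 (translate T W k) = ω.1 (translate T W (k - 1)) := by
    rw [← preimage_translate]
    exact Measure.map_apply T.measurable (measurableSet_translate T hW k)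
  rw [increment, this, increment]

theorem measurable_increment (T : X ≃ᵐ X) {W : Set X} (hW : MeasurableSet W) (d c : ℝ) (k : ℤ) :
    Measurable fun ω => increment T W d c ω k :=
  ((measurable_count (measurableSet_translate T hW k)).ennreal_toReal.sub_const c).const_mul d

theorem isFirstMax_increment_suspension (T : X ≃ᵐ X) {W : Set X} (hW : MeasurableSet W) (d c : ℝ)
    (ω : Config X) (n : ℤ) :
    IsFirstMax (increment T W d c (suspension T ω)) (n + 1) ↔
      IsFirstMax (increment T W d c ω) n := by
  have e₁ : ∀ i : ℕ, n + 1 + (i : ℤ) - 1 = n + i := fun i => by ring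
  have e₂ : ∀ i : ℕ, n + 1 - 1 - (i : ℤ) - 1 = n - 1 - i := fun i => by ring
  simp only [IsFirstMax, increment_suspension T hW, e₁, e₂]

theorem measurableSet_isFirstMax (T : X ≃ᵐ X) {W : Set X} (hW : MeasurableSet W) (d c : ℝ)
    (n : ℤ) : MeasurableSet {ω | IsFirstMax (increment T W d c ω) n} := by
  have hm : ∀ (m : ℕ) (f : ℕ → ℤ), Measurable fun ω =>
      ∑ i ∈ Finset.range m, increment T W d c ω (f i) := fun m f =>
    Finset.measurable_fun_sum _ fun i _ => measurable_increment T hW d c (f i)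
  simp only [IsFirstMax, Set.ofPred_and, Set.ofPred_forall]
  exact (MeasurableSet.iInter fun m => measurableSet_le (hm m _) measurable_const).inter
    (.iInter fun m => measurableSet_lt measurable_const (hm (m + 1) _))

theorem isTotallyDissipative_suspension {μ : Measure X} [SigmaFinite μ] {T : X ≃ᵐ X}
    (hT : MemAut₁ μ T) (hχ : chi μ T ≠ 0) :
    IsTotallyDissipative (poissonLaw μ) (suspension T) := by
  obtain ⟨W, hW, hμW, hd, hne⟩ := exists_wandering hT hχ
  have hV := measurableSet_translate T hW
  have hfin := measure_translate_ne_top hT hW hμW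
  have hsum : HasSum (fun k => μ.real (translate T W (k - 1)) - μ.real (translate T W k))
      (defect μ T (saturation T W)) := by
    simp_rw [← defect_translate hT hW hμW]
    exact hasSum_integral_iUnion hV hd hT.2.integrableOn
  obtain ⟨l₁, l₂, h₁, h₂, hl⟩ := exists_tendsto_of_hasSum (u := fun k => μ.real (translate T W k))
    hsum
  have hl' : l₁ ≠ l₂ := fun h => hne (by rw [hl, h, sub_self])
  -- With the midpoint, `c - l₂ = -(c - l₁)`. The increments with factor `c - l₁` drift downwards in
  -- the future, and the sign change in the past part of the walk turns them into increments with
  -- factor `c - l₂`, which drift downwards there as well.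
  set c := (l₁ + l₂) / 2 with hc
  have hc₁ : c ≠ l₁ := fun h => hl' (by linarith)
  have hc₂ : c ≠ l₂ := fun h => hl' (by linarith)
  let B : ℤ → Set (Config X) := fun n => {ω | IsFirstMax (increment T W (c - l₁) c ω) n}
  have himage : ∀ n : ℤ, ((suspension T).toEquiv ^ n : Equiv.Perm (Config X)) '' B 0 = B n :=
    perm_zpow_image _ fun n ω => isFirstMax_increment_suspension T hW _ c ω n
  refine ⟨B 0, measurableSet_isFirstMax T hW _ c 0, fun m n hmn => ?_, ?_⟩
  · change Disjoint (_ '' _) (_ '' _)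
    rw [himage, himage]
    exact Set.disjoint_left.2 fun ω hm hn => hmn (hm.unique hn)
  · simp_rw [himage]
    have a₁ := tendsto_sum_count μ (fun n => hV (n : ℤ)) (fun n => hfin (n : ℤ))
      (fun i j hij => hd (by simpa using hij)) h₁ hc₁
    have a₂ := tendsto_sum_count μ (fun n => hV (-1 - (n : ℤ))) (fun n => hfin (-1 - (n : ℤ)))
      (fun i j hij => hd (by simpa using hij)) h₂ hc₂
    refine mem_ae_iff.1 ?_
    filter_upwards [a₁, a₂] with ω hω₁ hω₂
    refine Set.mem_iUnion.2 (exists_isFirstMax hω₁ (hω₂.congr fun n => ?_))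
    rw [← Finset.sum_neg_distrib]
    refine Finset.sum_congr rfl fun i _ => ?_
    rw [increment, ← neg_mul]
    congr 1
    linarith

end PoissonSuspension

end

theorem theorem6p1 {X : Type*} [MeasurableSpace X] [StandardBorelSpace X]
    (μ : MeasureTheory.Measure X) [MeasureTheory.SigmaFinite μ]
    [MeasureTheory.NullSingletonClass μ] (hμ : μ Set.univ = ⊤)
    (T : X ≃ᵐ X) (hT : PoissonSuspension.MemAut₁ μ T) (hχ : PoissonSuspension.chi μ T ≠ 0) :
    PoissonSuspension.IsNonsingular (PoissonSuspension.poissonLaw μ)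
        (PoissonSuspension.suspension T) ∧
      PoissonSuspension.IsTotallyDissipative (PoissonSuspension.poissonLaw μ)
        (PoissonSuspension.suspension T) :=
  ⟨PoissonSuspension.isNonsingular_suspension hT,
    PoissonSuspension.isTotallyDissipative_suspension hT hχ⟩
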